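/- Let $n,m\ge 0$ be integers, let $\mathcal U\subset\mathbb R^m$ be nonempty and compact, and let $f:\mathbb R^n\times\mathcal U\to\mathbb R^n$ be Lipschitz. Let $\mathbb U$ be the set of measurable functions $\mathbf u:\mathbb R_{\ge 0}\to\mathcal U$, and for $x\in\mathbb R^n$, $\mathbf u\in\mathbb U$ let $\mathbf x_x^{\mathbf u}:\mathbb R_{\ge0}\to\mathbb R^n$ be the unique continuous function with $\mathbf x_x^{\mathbf u}(t)=x+\int_0^t f(\mathbf x_x^{\mathbf u}(s),\mathbf u(s))\,ds$ for all $t\ge 0$. Let $\alpha:\mathbb R_{\ge0}\to\mathbb R_{\ge0}$ be a locally Lipschitz class $\mathcal K$ function, i.e. locally Lipschitz, strictly increasing and with $\alpha(0)=0$. For $r\ge 0$ let $\beta_\alpha(r,\cdot):\mathbb R_{\ge0}\to\mathbb R_{\ge0}$ be the solution of $\dot y=-\alpha(y)$, $y(0)=r$. Let $h:\mathbb R^n\to\mathbb R_{\ge0}$ be continuous, and define $H_\alpha:\mathbb R^n\times\mathbb R_{\ge0}\times\mathbb R^n\to\mathbb R$ by $H_\alpha(x,r,\lambda)=\max_{u\in\mathcal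 U}\lambda\cdot f(x,u)+\alpha(r)$. The following are equivalent: 1. $h$ is a viscosity control barrier function with respect to $\alpha$: for every $x$ with $h(x)>0$ and every continuously differentiable $\varphi:\mathbb R^n\to\mathbb R$ such that $h-\varphi$ has a local maximum at $x$, one has $\max_{u\in\mathcal U}\nabla\varphi(x)\cdot f(x,u)\ge-\alpha(h(x))$. 2. $h$ is a viscosity solution of $-\min\{H_\alpha(x,h,\nabla h),0\}=0$ on $\mathbb R^n$: for every continuously differentiable $\varphi:\mathbb R^n\to\mathbb R$, one has $-\min\{H_\alpha(x_0,h(x_0),\nabla\varphi(x_0)),0\}\le 0$ at every local maximum point $x_0$ of $h-\varphi$, and $-\min\{H_\alpha(x_0,h(x_0),\nabla\varphi(x_0)),0\}\ge 0$ at every local minimum point $x_0$ of $h-\varphi$. 3. The control barrier value function $v:\mathbb R^n\times\mathbb R_{\ge0}\to\mathbb R_{\ge0}$ corresponding to $h$ and $\alpha$, defined implicitly by $$\beta_\alpha(v(x,T),T)=\sup_{\mathbf u\in\mathbb U}\min_{t\in[0,T]}\beta_\alpha\big(h(\mathbf x_x^{\mathbf u}(t)),T-t\big),$$ is time-invariant,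 i.e. $v(x,T)=h(x)$ for all $x\in\mathbb R^n$ and $T\ge0$. 4. $h$ provides the Barrier Guarantee with respect to $\alpha$: for each $\theta\in[0,1)$ and each $x\in\mathbb R^n$ with $h(x)>0$ there is a $\mathbf u\in\mathbb U$ such that $h(\mathbf x_x^{\mathbf u}(t))\ge\beta_\alpha(\theta h(x),t)$ for all $t\ge0$. -/

import Mathlib

open scoped NNReal Gradient

noncomputable section

namespace ViscosityCBF

/-- Class `𝒦` functions on `[0, ∞)`. -/
structure IsClassK (α : ℝ≥0 → ℝ≥0) : Prop where
  continuous : Continuous α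
  strictMono : StrictMono α
  map_zero : α 0 = 0

/-- `y`, restricted to `[0, ∞)`, solves `y' = -α(y)`, `y(0) = r`
(the derivative at `t = 0` is one-sided). -/
structure IsDecaySolution (α : ℝ≥0 → ℝ≥0) (r : ℝ≥0) (y : ℝ → ℝ≥0) : Prop where
  initial : y 0 = r
  deriv : ∀ t : ℝ, 0 ≤ t →
    HasDerivWithinAt (fun s : ℝ => (y s : ℝ)) (-(α (y t) : ℝ)) (Set.Ici 0) t

/-- `β_α(r, t)` for `t ≥ 0`: the value at time `t` of the solution of `y' = -α(y)`, `y(0) = r`.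
For `α` locally Lipschitz of class `𝒦` that solution exists and is unique on `[0, ∞)`. -/
def beta (α : ℝ≥0 → ℝ≥0) (r : ℝ≥0) (t : ℝ) : ℝ≥0 :=
  Classical.epsilon (fun y : ℝ → ℝ≥0 => IsDecaySolution α r y) t

section System

variable {n m : ℕ} {U : Set (EuclideanSpace ℝ (Fin m))}

/-- `ξ`, restricted to `[0, ∞)`, is the (Carathéodory) state trajectory of `ξ' = f(ξ, u)` from `x`
under the control signal `u`, of which only the values on `[0, ∞)` matter. -/
structure IsTrajectory (f : EuclideanSpace ℝ (Fin n) × U → EuclideanSpace ℝ (Fin n))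
    (u : ℝ → U) (x : EuclideanSpace ℝ (Fin n)) (ξ : ℝ → EuclideanSpace ℝ (Fin n)) : Prop where
  continuousOn : ContinuousOn ξ (Set.Ici 0)
  integral_eq : ∀ t : ℝ, 0 ≤ t → ξ t = x + ∫ s in (0 : ℝ)..t, f (ξ s, u s)

/-- `max_{u ∈ U} p · f(x, u)`; the supremum is attained for `U` compact nonempty, `f` continuous. -/
def maxRate (f : EuclideanSpace ℝ (Fin n) × U → EuclideanSpace ℝ (Fin n))
    (x p : EuclideanSpace ℝ (Fin n)) : ℝ :=
  ⨆ u : U, inner ℝ p (f (x, u))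

/-- The Hamiltonian `H_α(x, r, p) = max_{u ∈ U} p · f(x, u) + α(r)`. -/
def hamiltonian (f : EuclideanSpace ℝ (Fin n) × U → EuclideanSpace ℝ (Fin n)) (α : ℝ≥0 → ℝ≥0)
    (x : EuclideanSpace ℝ (Fin n)) (r : ℝ≥0) (p : EuclideanSpace ℝ (Fin n)) : ℝ :=
  maxRate f x p + α r

/-- `h` is a viscosity control barrier function with respect to `α`. -/
def IsViscosityCBF (f : EuclideanSpace ℝ (Fin n) × U → EuclideanSpace ℝ (Fin n))
    (α : ℝ≥0 → ℝ≥0) (h : EuclideanSpace ℝ (Fin n) → ℝ) : Prop :=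
  Continuous h ∧ ∀ x, 0 < h x → ∀ φ : EuclideanSpace ℝ (Fin n) → ℝ, ContDiff ℝ 1 φ →
    IsLocalMax (fun y => h y - φ y) x → maxRate f x (∇ φ x) ≥ -(α (h x).toNNReal : ℝ)

/-- Continuous viscosity sub-solutions `μ : ℝⁿ → [0, ∞)` of `F(z, μ, ∇μ) = 0`. -/
def IsViscositySubsolution
    (F : EuclideanSpace ℝ (Fin n) → ℝ≥0 → EuclideanSpace ℝ (Fin n) → ℝ)
    (μ : EuclideanSpace ℝ (Fin n) → ℝ≥0) : Prop :=
  Continuous μ ∧ ∀ φ : EuclideanSpace ℝ (Fin n) → ℝ, ContDiff ℝ 1 φ → ∀ z,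
    IsLocalMax (fun y => (μ y : ℝ) - φ y) z → F z (μ z) (∇ φ z) ≤ 0

/-- Continuous viscosity super-solutions `μ : ℝⁿ → [0, ∞)` of `F(z, μ, ∇μ) = 0`. -/
def IsViscositySupersolution
    (F : EuclideanSpace ℝ (Fin n) → ℝ≥0 → EuclideanSpace ℝ (Fin n) → ℝ)
    (μ : EuclideanSpace ℝ (Fin n) → ℝ≥0) : Prop :=
  Continuous μ ∧ ∀ φ : EuclideanSpace ℝ (Fin n) → ℝ, ContDiff ℝ 1 φ → ∀ z,
    IsLocalMin (fun y => (μ y : ℝ) - φ y) z → F z (μ z) (∇ φ z) ≥ 0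

/-- Continuous viscosity solutions `μ : ℝⁿ → [0, ∞)` of `F(z, μ, ∇μ) = 0`. -/
def IsViscositySolution
    (F : EuclideanSpace ℝ (Fin n) → ℝ≥0 → EuclideanSpace ℝ (Fin n) → ℝ)
    (μ : EuclideanSpace ℝ (Fin n) → ℝ≥0) : Prop :=
  IsViscositySubsolution F μ ∧ IsViscositySupersolution F μ

/-- `sup_u min_{t ∈ [0,T]} β_α(g(ξ(t)), T - t)`, over the measurable control signals `u`, with `ξ`
the trajectory from `x` under `u`. The set is bounded by `β_α(g(x), T)`. -/
def cbvfPayoff (f : EuclideanSpace ℝ (Fin n) × U → EuclideanSpace ℝ (Fin n)) (α : ℝ≥0 → ℝ≥0)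
    (g : EuclideanSpace ℝ (Fin n) → ℝ≥0) (x : EuclideanSpace ℝ (Fin n)) (T : ℝ≥0) : ℝ≥0 :=
  sSup {w : ℝ≥0 | ∃ (u : ℝ → U) (ξ : ℝ → EuclideanSpace ℝ (Fin n)),
    Measurable u ∧ IsTrajectory f u x ξ ∧
      w = ⨅ t : Set.Icc (0 : ℝ) (T : ℝ), beta α (g (ξ t)) ((T : ℝ) - t)}

/-- The control barrier value function of `g` and `α`: the number `v = v(x, T) ≥ 0` such that
`β_α(v, T) = sup_u min_{t ∈ [0,T]} β_α(g(ξ(t)), T - t)`. -/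
def cbvf (f : EuclideanSpace ℝ (Fin n) × U → EuclideanSpace ℝ (Fin n)) (α : ℝ≥0 → ℝ≥0)
    (g : EuclideanSpace ℝ (Fin n) → ℝ≥0) (x : EuclideanSpace ℝ (Fin n)) (T : ℝ≥0) : ℝ≥0 :=
  Classical.epsilon (fun v : ℝ≥0 => beta α v T = cbvfPayoff f α g x T)

/-- `B` provides the Barrier Guarantee with respect to `α`. -/
def ProvidesBarrierGuarantee
    (f : EuclideanSpace ℝ (Fin n) × U → EuclideanSpace ℝ (Fin n)) (α : ℝ≥0 → ℝ≥0)
    (B : EuclideanSpace ℝ (Fin n) → ℝ) : Prop :=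
  Continuous B ∧ ∀ θ : ℝ, 0 ≤ θ → θ < 1 → ∀ x, 0 < B x →
    ∃ (u : ℝ → U) (ξ : ℝ → EuclideanSpace ℝ (Fin n)), Measurable u ∧ IsTrajectory f u x ξ ∧
      ∀ t : ℝ, 0 ≤ t → B (ξ t) ≥ beta α (θ * B x).toNNReal t

end System

end ViscosityCBF

end

/-!
A zero of `h ≥ 0` is a minimum, so there the gradient of a test function touching `h` from above
vanishes and the subsolution inequality is free; elsewhere it is the barrier inequality, and the
supersolution inequality always holds. Thus (1) and (2) agree.

A time-invariant value function yields controls with `h(ξ(T)) ≥ β(h(x), T) - o(T)`; comparing this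
with the first-order bound along trajectories that a supergradient of `h` at `x` provides, as
`T → 0`, gives (3) ⇒ (1). Along a control as in (4), the semigroup law of `β` shows that the payoff
is at least `β(θh(x), T)`, and `θ → 1` gives (4) ⇒ (3).

For (1) ⇒ (4), `h` is regularized by its sup-convolution `a(z) = max_w (h(w) - q‖w - z‖²)`. At a
maximizer `y` the barrier inequality provides a control `v` with
`2q(y - z) · f(y, v) ≥ -α(h(y)) - η`. Holding `v` constant for a short time `δ`, started at `z`,
makes `a` decay no faster than `β` up to an error `o(1)δ`, uniformly over a ball. Repeating this
(sample-and-hold) keeps `h ≥ β(h(x), ·) - c` on a time interval whose length depends only on the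
Lipschitz constant of `f`. Since `β` is strictly monotone in its first argument, the strict
inequality `h > β(θh(x), ·)` survives such an interval, and finite pieces concatenate to all of
`[0, ∞)`.
-/

noncomputable section

namespace ViscosityCBF

open Set Filter Topology MeasureTheory

/-! ### Concatenating trajectory pieces -/

section Glue

variable {X : Type*} {δ : ℝ}

/-- Concatenation of a sequence of functions: `F k`, run on its own clock from time `0`, is used on
the slot `[kδ, (k + 1)δ)`. Only the values at times `t ≥ 0` are meaningful. -/
def glue (δ : ℝ) (F : ℕ → ℝ → X) (t : ℝ) : X := F ⌊t / δ⌋₊ (t - ⌊t / δ⌋₊ * δ)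

theorem exists_eq_natCast_mul_add (hδ : 0 < δ) {t : ℝ} (ht : 0 ≤ t) :
    ∃ k : ℕ, ∃ τ ∈ Ico 0 δ, t = k * δ + τ := by
  have h_le := (le_div_iff₀ hδ).1 (Nat.floor_le (div_nonneg ht hδ.le))
  have h_lt := (div_lt_iff₀ hδ).1 (Nat.lt_floor_add_one (t / δ))
  exact ⟨⌊t / δ⌋₊, t - ⌊t / δ⌋₊ * δ, ⟨by linarith, by linarith⟩, by ring⟩

theorem glue_natCast_mul_add (F : ℕ → ℝ → X) (k : ℕ) {τ : ℝ} (hτ : τ ∈ Ico 0 δ) :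
    glue δ F (k * δ + τ) = F k τ := by
  have hδ : 0 < δ := hτ.1.trans_lt hτ.2
  have h_nonneg : 0 ≤ k * δ + τ := add_nonneg (by positivity) hτ.1
  have h_floor : ⌊(k * δ + τ) / δ⌋₊ = k := by
    rw [Nat.floor_eq_iff (div_nonneg h_nonneg hδ.le), le_div_iff₀ hδ, div_lt_iff₀ hδ]
    exact ⟨by linarith [hτ.1], by linarith [hτ.2]⟩
  rw [glue, h_floor, add_sub_cancel_left]

theorem measurable_glue [MeasurableSpace X] (δ : ℝ) {F : ℕ → ℝ → X}
    (hF : ∀ k, Measurable (F k)) : Measurable (glue δ F) := by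
  have h_uncurry : Measurable fun p : ℕ × ℝ => F p.1 p.2 := measurable_from_prod_countable_right hF
  have h_slot : Measurable fun t : ℝ => ⌊t / δ⌋₊ := (measurable_id.div_const δ).nat_floor
  have h_cast : Measurable ((↑) : ℕ → ℝ) := measurable_from_nat
  exact h_uncurry.comp
    (h_slot.prodMk (measurable_id.sub ((h_cast.comp h_slot).mul_const δ)))

variable {E : Type*} [NormedAddCommGroup E] {g : ℕ → ℝ → E}

theorem eqOn_glue_comp_sub (g : ℕ → ℝ → X) (k : ℕ) {τ : ℝ} (hτ : τ ≤ δ) :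
    EqOn (fun s => g k (s - k * δ)) (glue δ g) (Ioo (k * δ) (k * δ + τ)) := fun s hs => by
  have h_glue := glue_natCast_mul_add g k (τ := s - k * δ)
    (δ := δ) ⟨by linarith [hs.1], by linarith [hs.2]⟩
  rwa [add_sub_cancel, eq_comm] at h_glue

theorem intervalIntegrable_glue_slot {k : ℕ} (hg : IntervalIntegrable (g k) volume 0 δ) {τ : ℝ}
    (hτ : τ ∈ Icc 0 δ) : IntervalIntegrable (glue δ g) volume (k * δ) (k * δ + τ) := by
  have h_prefix : IntervalIntegrable (g k) volume 0 τ :=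
    hg.mono_set (uIcc_subset_uIcc_left (by rwa [uIcc_of_le (hτ.1.trans hτ.2)]))
  have h_shift := h_prefix.comp_sub_right (k * δ)
  rw [zero_add, add_comm] at h_shift
  refine h_shift.congr_uIoo ?_
  rw [uIoo_of_le (le_add_of_nonneg_right hτ.1)]
  exact eqOn_glue_comp_sub g k hτ.2

theorem integral_glue_slot [NormedSpace ℝ E] (g : ℕ → ℝ → E) (k : ℕ) {τ : ℝ} (hτ : τ ∈ Icc 0 δ) :
    ∫ s in (k * δ)..(k * δ + τ), glue δ g s = ∫ s in (0 : ℝ)..τ, g k s := by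
  rw [← intervalIntegral.integral_congr_Ioo_of_le (le_add_of_nonneg_right hτ.1)
    (eqOn_glue_comp_sub g k hτ.2), intervalIntegral.integral_comp_sub_right, sub_self,
    add_sub_cancel_left]

theorem intervalIntegrable_glue_natCast_mul (hδ : 0 ≤ δ)
    (hg : ∀ k, IntervalIntegrable (g k) volume 0 δ) (k : ℕ) :
    IntervalIntegrable (glue δ g) volume 0 (k * δ) := by
  induction k with
  | zero => simp
  | succ k ih =>
    rw [Nat.cast_succ, add_one_mul]
    exact ih.trans (intervalIntegrable_glue_slot (hg k) (right_mem_Icc.2 hδ))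

end Glue

/-! ### Trajectories of control systems -/

section Trajectory

variable {E 𝒰 : Type*} [NormedAddCommGroup E] [NormedSpace ℝ E]
  {f : E × 𝒰 → E} {u : ℝ → 𝒰} {ξ : ℝ → E} {s : Set ℝ} {T δ : ℝ} {K : ℝ≥0}

/-- `ξ` is on the time set `s` a trajectory, started at time `0`, of the control system
`ξ' = f(ξ, u)`. Unlike in `IsTrajectory`, integrability of the velocity is part of the definition,
so that the integral is never a junk value. -/
structure IsTrajectoryOn (f : E × 𝒰 → E) (u : ℝ → 𝒰) (s : Set ℝ) (ξ : ℝ → E) : Prop where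
  intervalIntegrable : ∀ t ∈ s, IntervalIntegrable (fun τ => f (ξ τ, u τ)) volume 0 t
  integral_eq : ∀ t ∈ s, ξ t = ξ 0 + ∫ τ in (0 : ℝ)..t, f (ξ τ, u τ)

namespace IsTrajectoryOn

theorem mono {s' : Set ℝ} (h : IsTrajectoryOn f u s ξ) (hs : s' ⊆ s) : IsTrajectoryOn f u s' ξ :=
  ⟨fun t ht => h.intervalIntegrable t (hs ht), fun t ht => h.integral_eq t (hs ht)⟩

theorem sub_eq_integral (h : IsTrajectoryOn f u s ξ) {t : ℝ} (ht : t ∈ s) :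
    ξ t - ξ 0 = ∫ τ in (0 : ℝ)..t, f (ξ τ, u τ) :=
  sub_eq_of_eq_add' (h.integral_eq t ht)

theorem continuousOn_Icc (h : IsTrajectoryOn f u (Icc 0 T) ξ) : ContinuousOn ξ (Icc 0 T) := by
  rcases lt_or_ge T 0 with hT | hT
  · simp [Icc_eq_empty_of_lt hT]
  have h_primitive := intervalIntegral.continuousOn_primitive_interval'
    (h.intervalIntegrable T (right_mem_Icc.2 hT)) left_mem_uIcc
  rw [uIcc_of_le hT] at h_primitive
  exact (continuousOn_const.add h_primitive).congr h.integral_eq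

theorem concat (hδ : 0 < δ) {u : ℕ → ℝ → 𝒰} {ξ : ℕ → ℝ → E}
    (hξ : ∀ k, IsTrajectoryOn f (u k) (Icc 0 δ) (ξ k)) (h_next : ∀ k, ξ (k + 1) 0 = ξ k δ) :
    IsTrajectoryOn f (glue δ u) (Ici 0) (glue δ ξ) := by
  let g : ℕ → ℝ → E := fun k s => f (ξ k s, u k s)
  have hg : ∀ k, IntervalIntegrable (g k) volume 0 δ := fun k =>
    (hξ k).intervalIntegrable δ (right_mem_Icc.2 hδ.le)
  have h_node : ∀ k : ℕ, ξ k 0 = ξ 0 0 + ∫ s in (0 : ℝ)..(k * δ), glue δ g s := fun k => by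
    induction k with
    | zero => simp
    | succ k ih =>
      have hδ' : δ ∈ Icc 0 δ := right_mem_Icc.2 hδ.le
      rw [h_next, (hξ k).integral_eq δ hδ', ih, Nat.cast_succ, add_one_mul,
        ← intervalIntegral.integral_add_adjacent_intervals
          (intervalIntegrable_glue_natCast_mul hδ.le hg k)
          (intervalIntegrable_glue_slot (hg k) hδ'),
        integral_glue_slot g k hδ', add_assoc]
  have h_zero : glue δ ξ 0 = ξ 0 0 := by simp [glue]
  constructor <;> intro t ht <;> obtain ⟨k, τ, hτ, rfl⟩ := exists_eq_natCast_mul_add hδ ht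
  · exact (intervalIntegrable_glue_natCast_mul hδ.le hg k).trans
      (intervalIntegrable_glue_slot (hg k) (Ico_subset_Icc_self hτ))
  · have hτ' := Ico_subset_Icc_self hτ
    change _ = _ + ∫ s in (0 : ℝ)..(k * δ + τ), glue δ g s
    rw [glue_natCast_mul_add ξ k hτ, (hξ k).integral_eq τ hτ', h_node, h_zero,
      ← intervalIntegral.integral_add_adjacent_intervals
        (intervalIntegrable_glue_natCast_mul hδ.le hg k) (intervalIntegrable_glue_slot (hg k) hτ'),
      integral_glue_slot g k hτ', add_assoc]

end IsTrajectoryOn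

theorem exists_isTrajectoryOn_Ici_of_step [MeasurableSpace 𝒰] (hδ : 0 < δ) {P Q : ℝ → E → Prop}
    (h_step : ∀ s, 0 ≤ s → ∀ z, P s z → ∃ u ξ, Measurable u ∧ ξ 0 = z ∧
      IsTrajectoryOn f u (Icc 0 δ) ξ ∧ P (s + δ) (ξ δ) ∧ ∀ t ∈ Icc 0 δ, Q (s + t) (ξ t))
    {x : E} (hx : P 0 x) :
    ∃ u ξ, Measurable u ∧ ξ 0 = x ∧ IsTrajectoryOn f u (Ici 0) ξ ∧ ∀ t, 0 ≤ t → Q t (ξ t) := by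
  have : Nonempty (ℝ → 𝒰) := ⟨(h_step 0 le_rfl x hx).choose⟩
  choose! u ξ hu hξ0 hξ hP hQ using h_step
  let z : ℕ → E := fun k => Nat.rec x (fun j w => ξ (j * δ) w δ) k
  have h_time (k : ℕ) : 0 ≤ k * δ := by positivity
  have hz : ∀ k : ℕ, P (k * δ) (z k) := fun k => by
    induction k with
    | zero => simpa [z] using hx
    | succ k ih =>
      rw [Nat.cast_succ, add_one_mul]
      exact hP _ (h_time k) _ ih
  refine ⟨glue δ fun k => u (k * δ) (z k), glue δ fun k => ξ (k * δ) (z k),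
    measurable_glue δ fun k => hu _ (h_time k) _ (hz k), ?_,
    IsTrajectoryOn.concat hδ (fun k => hξ _ (h_time k) _ (hz k))
      fun k => hξ0 _ (h_time (k + 1)) _ (hz (k + 1)), fun t ht => ?_⟩
  · simpa [glue, z] using hξ0 _ (h_time 0) _ (hz 0)
  · obtain ⟨k, τ, hτ, rfl⟩ := exists_eq_natCast_mul_add hδ ht
    rw [glue_natCast_mul_add _ k hτ]
    exact hQ _ (h_time k) _ (hz k) _ (Ico_subset_Icc_self hτ)

theorem Icc_mem_nhdsWithin_Ici_of_lt {a b t : ℝ} (htb : t < b) : Icc a b ∈ 𝓝[Ici a] t := by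
  rw [← Ici_inter_Iic]
  exact inter_mem self_mem_nhdsWithin (mem_nhdsWithin_of_mem_nhds (Iic_mem_nhds htb))

theorem exists_isTrajectoryOn_const [CompleteSpace E] {v : 𝒰}
    (hf : LipschitzWith K fun y => f (y, v)) (hδ : 0 ≤ δ) (hKδ : K * δ ≤ 1 / 2) (z : E) :
    ∃ ξ, ξ 0 = z ∧ IsTrajectoryOn f (fun _ => v) (Icc 0 δ) ξ := by
  have hPL : IsPicardLindelof (fun _ y => f (y, v)) (⟨0, left_mem_Icc.2 hδ⟩ : Icc (0 : ℝ) δ) z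
      (2 * ‖f (z, v)‖₊ * δ.toNNReal) 0 (2 * ‖f (z, v)‖₊) K := by
    refine IsPicardLindelof.of_time_independent (f := fun y => f (y, v)) (fun y hy => ?_)
      hf.lipschitzOnWith (by simp [hδ])
    rw [mem_closedBall_iff_norm] at hy
    push_cast [Real.coe_toNNReal _ hδ] at hy ⊢
    have h_half : (K : ℝ) * ‖y - z‖ ≤ ‖f (z, v)‖ := by
      calc (K : ℝ) * ‖y - z‖ ≤ K * (2 * ‖f (z, v)‖ * δ) := by gcongr
        _ = K * δ * (2 * ‖f (z, v)‖) := by ring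
        _ ≤ 1 / 2 * (2 * ‖f (z, v)‖) := by gcongr
        _ = ‖f (z, v)‖ := by ring
    linarith [norm_le_insert' (f (y, v)) (f (z, v)), hf.norm_sub_le y z]
  obtain ⟨ξ, hξ0, hξ⟩ := hPL.exists_eq_forall_mem_Icc_hasDerivWithinAt₀
  have h_cont : ContinuousOn ξ (Icc 0 δ) := fun t ht => (hξ t ht).continuousWithinAt
  have h_sub {t : ℝ} (ht : t ∈ Icc 0 δ) : uIcc 0 t ⊆ Icc 0 δ := by
    rw [uIcc_of_le ht.1]; exact Icc_subset_Icc_right ht.2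
  refine ⟨ξ, hξ0, fun t ht => ContinuousOn.intervalIntegrable
    (hf.continuous.comp_continuousOn (h_cont.mono (h_sub ht))), fun t ht => ?_⟩
  rw [← ODE.picard_eq_of_hasDerivAt (f := fun _ y => f (y, v)) (α := ξ) (t₀ := 0) (t := t)
    (u := univ) (hf.continuous.comp continuous_snd).continuousOn
    (fun s hs => (hξ s (h_sub ht hs)).mono (h_sub ht)) (fun _ _ => mem_univ _), ODE.picard_apply]

theorem exists_forall_hasDerivWithinAt_Ici_of_lipschitzWith [CompleteSpace E] {G : E → E}
    (hG : LipschitzWith K G) (x : E) :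
    ∃ y : ℝ → E, y 0 = x ∧ ∀ t ∈ Ici 0, HasDerivWithinAt y (G (y t)) (Ici 0) t := by
  obtain ⟨δ, hδ, hKδ⟩ := exists_pos_mul_lt (one_half_pos (α := ℝ)) K
  let f : E × Unit → E := fun p => G p.1
  obtain ⟨u, y, -, hy0, hy, -⟩ := exists_isTrajectoryOn_Ici_of_step (f := f) (x := x)
    (P := fun _ _ => True) (Q := fun _ _ => True) hδ (fun _ _ z _ => by
      obtain ⟨ξ, hξ0, hξ⟩ := exists_isTrajectoryOn_const (f := f) (v := ()) hG hδ.le hKδ.le z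
      exact ⟨_, ξ, measurable_const, hξ0, hξ, trivial, fun _ _ => trivial⟩) trivial
  refine ⟨y, hy0, fun t ht => ?_⟩
  have hy' : IsTrajectoryOn f u (Icc 0 (t + 1)) y := hy.mono Icc_subset_Ici_self
  have ht' : t ∈ Icc 0 (t + 1) := ⟨ht, by linarith⟩
  have h_deriv := ODE.hasDerivWithinAt_picard_Icc (f := fun _ => G) (u := univ)
    (left_mem_Icc.2 (ht'.1.trans ht'.2)) (hG.continuous.comp continuous_snd).continuousOn
    hy'.continuousOn_Icc (fun _ _ => mem_univ _) (y 0) ht'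
  exact (h_deriv.congr_of_mem (fun s hs => hy'.integral_eq s hs) ht').mono_of_mem_nhdsWithin
    (Icc_mem_nhdsWithin_Ici_of_lt (lt_add_one t))

theorem IsTrajectoryOn.continuousOn_Ici (h : IsTrajectoryOn f u (Ici 0) ξ) :
    ContinuousOn ξ (Ici 0) := fun t ht =>
  ((h.mono Icc_subset_Ici_self).continuousOn_Icc t ⟨ht, (lt_add_one t).le⟩).mono_of_mem_nhdsWithin
    (Icc_mem_nhdsWithin_Ici_of_lt (lt_add_one t))

theorem IsTrajectoryOn.norm_sub_le (hf : ∀ v, LipschitzWith K fun y => f (y, v))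
    (hξ : IsTrajectoryOn f u (Icc 0 T) ξ) (hKT : K * T ≤ 1 / 2) {M : ℝ}
    (hM : ∀ v, ‖f (ξ 0, v)‖ ≤ M) : ∀ t ∈ Icc 0 T, ‖ξ t - ξ 0‖ ≤ 2 * M * T := by
  intro t ht
  obtain ⟨s, hs, h_max⟩ := isCompact_Icc.exists_isMaxOn ⟨t, ht⟩
    (f := fun t => ‖ξ t - ξ 0‖) (hξ.continuousOn_Icc.sub continuousOn_const).norm
  set D := ‖ξ s - ξ 0‖ with hD
  have hM0 : 0 ≤ M := (norm_nonneg _).trans (hM (u 0))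
  have : 0 ≤ D := norm_nonneg _
  have h_speed : ∀ τ ∈ uIoc 0 s, ‖f (ξ τ, u τ)‖ ≤ M + K * D := fun τ hτ => by
    rw [uIoc_of_le hs.1] at hτ
    have h_dist : ‖ξ τ - ξ 0‖ ≤ D := h_max ⟨hτ.1.le, hτ.2.trans hs.2⟩
    calc ‖f (ξ τ, u τ)‖ ≤ ‖f (ξ 0, u τ)‖ + ‖f (ξ τ, u τ) - f (ξ 0, u τ)‖ := norm_le_insert' _ _
      _ ≤ M + K * D := add_le_add (hM _) (((hf _).norm_sub_le _ _).trans (by gcongr))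
  have h_dist : D ≤ (M + K * D) * T := by
    calc D = ‖∫ τ in (0 : ℝ)..s, f (ξ τ, u τ)‖ := by rw [hD, hξ.sub_eq_integral hs]
      _ ≤ (M + K * D) * |s - 0| := intervalIntegral.norm_integral_le_of_norm_le_const h_speed
      _ ≤ (M + K * D) * T := by rw [sub_zero, abs_of_nonneg hs.1]; gcongr; exact hs.2
  have h_absorb : K * T * D ≤ 1 / 2 * D := by gcongr
  have h_dist_t : ‖ξ t - ξ 0‖ ≤ D := h_max ht
  linarith

end Trajectory

section ControlDynamics

variable {E 𝒰 : Type*} [NormedAddCommGroup E] [MeasurableSpace E] [MeasurableSpace 𝒰]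
  {f : E × 𝒰 → E} {K : ℝ≥0}

/-- Velocity fields of control systems whose trajectories are unique and exist for all times:
measurable, Lipschitz in the state uniformly in the control, and with a bounded set of available
velocities at each state. -/
structure IsControlDynamics (f : E × 𝒰 → E) (K : ℝ≥0) : Prop where
  measurable : Measurable f
  lipschitzWith : ∀ v, LipschitzWith K fun x => f (x, v)
  isBounded_range : ∀ x, Bornology.IsBounded (range fun v => f (x, v))

namespace IsControlDynamics

theorem exists_pos_norm_le (hf : IsControlDynamics f K) (x : E) :
    ∃ M > 0, ∀ v, ‖f (x, v)‖ ≤ M := by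
  obtain ⟨M, hM0, hM⟩ := (hf.isBounded_range x).exists_pos_norm_le
  exact ⟨M, hM0, fun v => hM _ (mem_range_self v)⟩

theorem norm_le_add (hf : IsControlDynamics f K) {x : E} {M : ℝ} (hM : ∀ v, ‖f (x, v)‖ ≤ M)
    (y : E) (v : 𝒰) : ‖f (y, v)‖ ≤ M + K * ‖y - x‖ :=
  (norm_le_insert' _ _).trans (add_le_add (hM v) ((hf.lipschitzWith v).norm_sub_le y x))

theorem intervalIntegrable [BorelSpace E] [SecondCountableTopology E] {u : ℝ → 𝒰} {ξ : ℝ → E}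
    {T : ℝ} (hf : IsControlDynamics f K) (hu : Measurable u) (hT : 0 ≤ T)
    (hξ : ContinuousOn ξ (Icc 0 T)) : IntervalIntegrable (fun t => f (ξ t, u t)) volume 0 T := by
  obtain ⟨M, -, hM⟩ := hf.exists_pos_norm_le (ξ 0)
  obtain ⟨D, hD⟩ := isCompact_Icc.exists_bound_of_continuousOn (f := fun t => ξ t - ξ 0)
    (hξ.sub continuousOn_const)
  refine (intervalIntegrable_iff_integrableOn_Icc_of_le hT).2 ?_
  refine Integrable.of_bound (C := M + K * D) (hf.measurable.comp_aemeasurable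
    ((hξ.aemeasurable measurableSet_Icc).prodMk hu.aemeasurable)).aestronglyMeasurable ?_
  filter_upwards [ae_restrict_mem measurableSet_Icc] with t ht
  exact (hf.norm_le_add hM (ξ t) (u t)).trans (by gcongr; exact hD t ht)

end IsControlDynamics

theorem isControlDynamics_of_isCompact [BorelSpace E] [SecondCountableTopology E] {F : Type*}
    [PseudoMetricSpace F] [MeasurableSpace F] [BorelSpace F] {U : Set F} (hU : IsCompact U)
    {f : E × U → E} (hf : LipschitzWith K f) : IsControlDynamics f K where
  measurable := hf.continuous.measurable
  lipschitzWith v := by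
    simpa [Function.comp_def] using hf.comp (LipschitzWith.prodMk_right v)
  isBounded_range x := by
    have : CompactSpace U := isCompact_iff_compactSpace.1 hU
    exact (isCompact_range (hf.continuous.comp (Continuous.prodMk_right x))).isBounded

end ControlDynamics

section Inner

variable {E 𝒰 : Type*} [NormedAddCommGroup E] [InnerProductSpace ℝ E] [CompleteSpace E]
  {f : E × 𝒰 → E} {u : ℝ → 𝒰} {ξ : ℝ → E} {T c : ℝ}

theorem IsTrajectoryOn.inner_sub_le (hξ : IsTrajectoryOn f u (Icc 0 T) ξ) (hT : 0 ≤ T) (p : E)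
    (hc : ∀ t ∈ Icc 0 T, inner ℝ p (f (ξ t, u t)) ≤ c) : inner ℝ p (ξ T - ξ 0) ≤ T * c := by
  have h_int := hξ.intervalIntegrable T (right_mem_Icc.2 hT)
  have h_int_inner : IntervalIntegrable (fun t => inner ℝ p (f (ξ t, u t))) volume 0 T :=
    ⟨h_int.1.const_inner p, h_int.2.const_inner p⟩
  calc inner ℝ p (ξ T - ξ 0) = ∫ t in (0 : ℝ)..T, inner ℝ p (f (ξ t, u t)) := by
        rw [hξ.sub_eq_integral (right_mem_Icc.2 hT)]
        exact ((innerSL ℝ p).intervalIntegral_comp_comm h_int).symm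
    _ ≤ ∫ _ in (0 : ℝ)..T, c :=
        intervalIntegral.integral_mono_on hT h_int_inner intervalIntegrable_const hc
    _ = T * c := by simp

theorem IsTrajectoryOn.le_inner_sub (hξ : IsTrajectoryOn f u (Icc 0 T) ξ) (hT : 0 ≤ T) (p : E)
    (hc : ∀ t ∈ Icc 0 T, c ≤ inner ℝ p (f (ξ t, u t))) : T * c ≤ inner ℝ p (ξ T - ξ 0) := by
  have h_neg := hξ.inner_sub_le hT (-p) (c := -c) fun t ht => by
    rw [inner_neg_left]
    exact neg_le_neg (hc t ht)
  rw [inner_neg_left] at h_neg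
  linarith

end Inner

section System

variable {n m : ℕ} {U : Set (EuclideanSpace ℝ (Fin m))}
  {f : EuclideanSpace ℝ (Fin n) × U → EuclideanSpace ℝ (Fin n)} {K : ℝ≥0} {u : ℝ → U}
  {x : EuclideanSpace ℝ (Fin n)} {ξ : ℝ → EuclideanSpace ℝ (Fin n)}

theorem IsTrajectory.apply_zero (h : IsTrajectory f u x ξ) : ξ 0 = x := by
  simpa using h.integral_eq 0 le_rfl

theorem IsTrajectory.isTrajectoryOn (h : IsTrajectory f u x ξ) (hf : IsControlDynamics f K)
    (hu : Measurable u) : IsTrajectoryOn f u (Ici 0) ξ :=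
  ⟨fun _ ht => hf.intervalIntegrable hu ht (h.continuousOn.mono Icc_subset_Ici_self),
    fun t ht => by rw [h.apply_zero, h.integral_eq t ht]⟩

theorem IsTrajectoryOn.isTrajectory (h : IsTrajectoryOn f u (Ici 0) ξ) :
    IsTrajectory f u (ξ 0) ξ :=
  ⟨h.continuousOn_Ici, h.integral_eq⟩

end System

/-! ### The decay equation `y' = -α(y)` -/

section Decay

theorem antitoneOn_of_forall_hasDerivWithinAt_nonpos {s : Set ℝ} (hs : Convex ℝ s) {y y' : ℝ → ℝ}
    (hy : ∀ t ∈ s, HasDerivWithinAt y (y' t) s t) (h_nonpos : ∀ t ∈ s, y' t ≤ 0) :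
    AntitoneOn y s :=
  antitoneOn_of_hasDerivWithinAt_nonpos hs (fun t ht => (hy t ht).continuousWithinAt)
    (fun t ht => (hy t (interior_subset ht)).mono interior_subset)
    fun t ht => h_nonpos t (interior_subset ht)

theorem abs_sub_le_of_antitone {F : ℝ → ℝ} (hF : Antitone F) {s : Set ℝ} (hs : Convex ℝ s)
    {y z : ℝ → ℝ} (hy : ∀ t ∈ s, HasDerivWithinAt y (F (y t)) s t)
    (hz : ∀ t ∈ s, HasDerivWithinAt z (F (z t)) s t) {a b : ℝ} (ha : a ∈ s) (hb : b ∈ s)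
    (hab : a ≤ b) : |y b - z b| ≤ |y a - z a| := by
  have h_deriv : ∀ t ∈ s, HasDerivWithinAt (fun t => (y t - z t) ^ 2)
      (2 * ((y t - z t) * (F (y t) - F (z t)))) s t := fun t ht => by
    simpa [mul_assoc] using ((hy t ht).fun_sub (hz t ht)).fun_pow 2
  refine sq_le_sq.1 (antitoneOn_of_forall_hasDerivWithinAt_nonpos hs h_deriv (fun t _ => ?_)
    ha hb hab)
  refine mul_nonpos_of_nonneg_of_nonpos two_pos.le ?_
  rcases le_total (y t) (z t) with h | h
  · exact mul_nonpos_of_nonpos_of_nonneg (sub_nonpos.2 h) (sub_nonneg.2 (hF h))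
  · exact mul_nonpos_of_nonneg_of_nonpos (sub_nonneg.2 h) (sub_nonpos.2 (hF h))

/-- Rates `α`, not necessarily strictly increasing, with which `y' = -α(y)` is solvable on
`[0, ∞)`, uniquely both forwards and backwards in time. -/
structure IsDecayRate (α : ℝ≥0 → ℝ≥0) : Prop where
  monotone : Monotone α
  map_zero : α 0 = 0
  locallyLipschitz : LocallyLipschitz α

variable {α : ℝ≥0 → ℝ≥0}

theorem IsClassK.isDecayRate (hα : IsClassK α) (h_lip : LocallyLipschitz α) : IsDecayRate α :=
  ⟨hα.strictMono.monotone, hα.map_zero, h_lip⟩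

/-- The right-hand side of `y' = -α(y)`, extended by `0` to the negative half-line. -/
def decayField (α : ℝ≥0 → ℝ≥0) (y : ℝ) : ℝ := -(α y.toNNReal : ℝ)

theorem decayField_coe (α : ℝ≥0 → ℝ≥0) (r : ℝ≥0) : decayField α r = -(α r : ℝ) := by
  rw [decayField, Real.toNNReal_coe]

theorem decayField_nonpos (α : ℝ≥0 → ℝ≥0) (y : ℝ) : decayField α y ≤ 0 :=
  neg_nonpos.2 (NNReal.coe_nonneg _)

theorem IsDecaySolution.hasDerivWithinAt {r : ℝ≥0} {y : ℝ → ℝ≥0} (hy : IsDecaySolution α r y)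
    {t : ℝ} (ht : t ∈ Ici (0 : ℝ)) :
    HasDerivWithinAt (fun s : ℝ => (y s : ℝ)) (decayField α (y t)) (Ici 0) t := by
  rw [decayField_coe]
  exact hy.deriv t ht

namespace IsDecayRate

variable (hα : IsDecayRate α)
include hα

theorem antitone_decayField : Antitone (decayField α) := fun _ _ h =>
  neg_le_neg (NNReal.coe_le_coe.2 (hα.monotone (Real.toNNReal_mono h)))

theorem exists_lipschitzOnWith (r : ℝ≥0) : ∃ L : ℝ≥0, LipschitzOnWith L α (Icc 0 r) :=
  hα.locallyLipschitz.locallyLipschitzOn.exists_lipschitzOnWith_of_compact isCompact_Icc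

theorem exists_lipschitzWith_decayField_min (r : ℝ≥0) :
    ∃ L : ℝ≥0, LipschitzWith L fun y => decayField α (min y r) := by
  obtain ⟨L, hL⟩ := hα.exists_lipschitzOnWith r
  have h_clip : LipschitzWith 1 fun y : ℝ => (min y r).toNNReal := by
    simpa [Function.comp_def] using
      Real.lipschitzWith_toNNReal.comp (LipschitzWith.id.min_const (r : ℝ))
  have h_mapsTo : MapsTo (fun y : ℝ => (min y r).toNNReal) univ (Icc 0 r) := fun y _ =>
    ⟨zero_le, Real.toNNReal_le_iff_le_coe.2 (min_le_right _ _)⟩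
  have h_comp := lipschitzOnWith_univ.1 (hL.comp h_clip.lipschitzOnWith h_mapsTo)
  exact ⟨_, (NNReal.isometry_coe.lipschitz.comp h_comp).neg⟩

theorem exists_isDecaySolution (r : ℝ≥0) : ∃ y, IsDecaySolution α r y := by
  obtain ⟨L, hL⟩ := hα.exists_lipschitzWith_decayField_min r
  obtain ⟨y, hy0, hy⟩ := exists_forall_hasDerivWithinAt_Ici_of_lipschitzWith hL (r : ℝ)
  have h_anti : AntitoneOn y (Ici 0) :=
    antitoneOn_of_forall_hasDerivWithinAt_nonpos (convex_Ici 0) hy fun _ _ => decayField_nonpos _ _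
  have h_le : ∀ t ∈ Ici (0 : ℝ), y t ≤ r := fun t ht => hy0 ▸ h_anti self_mem_Ici ht ht
  have h_nonneg : ∀ t ∈ Ici (0 : ℝ), 0 ≤ y t := fun t ht => by
    by_contra! h_neg
    obtain ⟨s, hs, hys⟩ := intermediate_value_Icc' ht
      (fun a ha => (hy a ha.1).continuousWithinAt.mono Icc_subset_Ici_self)
      (⟨h_neg.le, by rw [hy0]; exact r.coe_nonneg⟩ : (0 : ℝ) ∈ Icc (y t) (y 0))
    have h_zero : ∀ a ∈ Ici (0 : ℝ),
        HasDerivWithinAt (fun _ => (0 : ℝ)) (decayField α (min 0 r)) (Ici 0) a := fun a _ => by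
      simpa [decayField, hα.map_zero] using hasDerivWithinAt_const a (Ici 0) (0 : ℝ)
    have h_contract := abs_sub_le_of_antitone
      (hα.antitone_decayField.comp_monotone (monotone_id.min monotone_const)) (convex_Ici 0)
      hy h_zero hs.1 ht hs.2
    rw [hys, sub_zero, sub_zero, abs_zero] at h_contract
    exact h_neg.ne (abs_nonpos_iff.1 h_contract)
  have h_coe : ∀ t ∈ Ici (0 : ℝ), ((y t).toNNReal : ℝ) = y t := fun t ht =>
    Real.coe_toNNReal _ (h_nonneg t ht)
  refine ⟨fun t => (y t).toNNReal, by simp [hy0], fun t ht => ?_⟩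
  have h_deriv := (hy t ht).congr_of_mem h_coe ht
  rwa [min_eq_left (h_le t ht)] at h_deriv

theorem isDecaySolution_beta (r : ℝ≥0) : IsDecaySolution α r (beta α r) :=
  Classical.epsilon_spec (hα.exists_isDecaySolution r)

theorem hasDerivWithinAt_beta (r : ℝ≥0) : ∀ t ∈ Ici (0 : ℝ),
    HasDerivWithinAt (fun s => (beta α r s : ℝ)) (decayField α (beta α r t)) (Ici 0) t :=
  fun _ => (hα.isDecaySolution_beta r).hasDerivWithinAt

theorem beta_zero_time (r : ℝ≥0) : beta α r 0 = r := (hα.isDecaySolution_beta r).initial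

theorem continuousOn_beta (r : ℝ≥0) : ContinuousOn (fun t => (beta α r t : ℝ)) (Ici 0) :=
  fun t ht => (hα.hasDerivWithinAt_beta r t ht).continuousWithinAt

theorem antitoneOn_beta (r : ℝ≥0) : AntitoneOn (beta α r) (Ici 0) := fun _ ha _ hb hab =>
  NNReal.coe_le_coe.1 (antitoneOn_of_forall_hasDerivWithinAt_nonpos (convex_Ici 0)
    (hα.hasDerivWithinAt_beta r) (fun _ _ => decayField_nonpos _ _) ha hb hab)

variable {t : ℝ} (ht : 0 ≤ t)
include ht

theorem eq_beta {r : ℝ≥0} {y : ℝ → ℝ≥0} (hy : IsDecaySolution α r y) : y t = beta α r t := by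
  have h_contract := abs_sub_le_of_antitone hα.antitone_decayField (convex_Ici 0)
    (fun _ => hy.hasDerivWithinAt) (hα.hasDerivWithinAt_beta r) self_mem_Ici ht ht
  rw [hy.initial, hα.beta_zero_time, sub_self, abs_zero] at h_contract
  exact NNReal.coe_injective (sub_eq_zero.1 (abs_nonpos_iff.1 h_contract))

theorem beta_zero_left : beta α 0 t = 0 :=
  (hα.eq_beta ht (y := fun _ => 0) ⟨rfl, fun t _ => by
    simpa [hα.map_zero] using hasDerivWithinAt_const t (Ici 0) (0 : ℝ)⟩).symm

theorem beta_beta (r : ℝ≥0) {s : ℝ} (hs : 0 ≤ s) :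
    beta α (beta α r s) t = beta α r (s + t) := by
  refine (hα.eq_beta ht (y := fun t => beta α r (s + t)) ⟨by simp, fun t ht => ?_⟩).symm
  have h_outer := (hα.isDecaySolution_beta r).deriv (s + t) (add_nonneg hs ht)
  have h_shift : HasDerivWithinAt (s + ·) 1 (Ici 0) t := (hasDerivWithinAt_id t _).const_add s
  simpa [Function.comp_def] using
    HasDerivWithinAt.scomp t h_outer h_shift fun _ ha => add_nonneg hs ha

theorem beta_le (r : ℝ≥0) : beta α r t ≤ r := by
  simpa only [hα.beta_zero_time] using hα.antitoneOn_beta r self_mem_Ici ht ht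

theorem abs_beta_sub_beta_le (p q : ℝ≥0) :
    |(beta α p t : ℝ) - beta α q t| ≤ |(p : ℝ) - q| := by
  simpa only [hα.beta_zero_time] using abs_sub_le_of_antitone hα.antitone_decayField
    (convex_Ici 0) (hα.hasDerivWithinAt_beta p) (hα.hasDerivWithinAt_beta q) self_mem_Ici ht ht

theorem continuous_beta_left : Continuous fun r => beta α r t :=
  (LipschitzWith.of_dist_le_mul (K := 1) fun p q => by
    simpa [NNReal.dist_eq] using hα.abs_beta_sub_beta_le ht p q).continuous

theorem injective_beta_left : Function.Injective fun r => beta α r t := by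
  intro p q (hpq : beta α p t = beta α q t)
  obtain ⟨L, hL⟩ := hα.exists_lipschitzWith_decayField_min (max p q)
  have h_cont (r : ℝ≥0) : ContinuousOn (fun s => (beta α r s : ℝ)) (Icc 0 t) :=
    (hα.continuousOn_beta r).mono Icc_subset_Ici_self
  have h_deriv {r : ℝ≥0} (hr : r ≤ max p q) : ∀ s ∈ Ioc 0 t,
      HasDerivWithinAt (fun s => (beta α r s : ℝ))
        (decayField α (min (beta α r s) (max p q : ℝ≥0))) (Iic s) s := fun s hs => by
    rw [min_eq_left (NNReal.coe_le_coe.2 ((hα.beta_le hs.1.le r).trans hr))]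
    exact ((hα.hasDerivWithinAt_beta r s hs.1.le).hasDerivAt (Ici_mem_nhds hs.1)).hasDerivWithinAt
  have h_eqOn := ODE_solution_unique_of_mem_Icc_left (s := fun _ => univ)
    (v := fun _ y => decayField α (min y (max p q : ℝ≥0))) (fun _ _ => hL.lipschitzOnWith)
    (h_cont p) (h_deriv (le_max_left p q)) (fun _ _ => mem_univ _)
    (h_cont q) (h_deriv (le_max_right p q)) (fun _ _ => mem_univ _) (congrArg _ hpq)
  simpa [hα.beta_zero_time] using h_eqOn (left_mem_Icc.2 ht)

theorem strictMono_beta_left : StrictMono fun r => beta α r t := by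
  refine ((hα.continuous_beta_left ht).strictMono_of_inj
    (hα.injective_beta_left ht)).resolve_right fun h_anti => ?_
  have h_lt := h_anti (zero_lt_one (α := ℝ≥0))
  simp only [hα.beta_zero_left ht, not_lt_zero] at h_lt

theorem beta_le_beta_add {p q : ℝ≥0} {c : ℝ} (hc : 0 ≤ c) (hpq : (p : ℝ) ≤ q + c) :
    (beta α p t : ℝ) ≤ beta α q t + c := by
  rcases le_total p q with h | h
  · exact le_add_of_le_of_nonneg
      (NNReal.coe_le_coe.2 ((hα.strictMono_beta_left ht).monotone h)) hc
  · have h_contract := (le_abs_self _).trans (hα.abs_beta_sub_beta_le ht p q)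
    rw [abs_of_nonneg (sub_nonneg.2 (NNReal.coe_le_coe.2 h))] at h_contract
    linarith

theorem sub_mul_le_beta (r : ℝ≥0) : (r : ℝ) - t * α r ≤ beta α r t := by
  have h_deriv : ∀ s ∈ Ici (0 : ℝ), HasDerivWithinAt (fun s => -(beta α r s : ℝ) - s * α r)
      (-decayField α (beta α r s) - α r) (Ici 0) s := fun s hs => by
    simpa using (hα.hasDerivWithinAt_beta r s hs).fun_neg.fun_sub
      ((hasDerivWithinAt_id s (Ici 0)).mul_const (α r : ℝ))
  have h_anti := antitoneOn_of_forall_hasDerivWithinAt_nonpos (convex_Ici 0) h_deriv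
    (fun s hs => by
      rw [decayField_coe, neg_neg, sub_nonpos]
      exact NNReal.coe_le_coe.2 (hα.monotone (hα.beta_le hs r))) self_mem_Ici ht ht
  simp only [hα.beta_zero_time] at h_anti
  linarith

theorem beta_le_sub_mul (r : ℝ≥0) : (beta α r t : ℝ) ≤ r - t * α (beta α r t) := by
  have h_deriv : ∀ s ∈ Icc 0 t, HasDerivWithinAt
      (fun s => (beta α r s : ℝ) + s * α (beta α r t))
      (decayField α (beta α r s) + α (beta α r t)) (Icc 0 t) s := fun s hs => by
    simpa using ((hα.hasDerivWithinAt_beta r s hs.1).mono Icc_subset_Ici_self).fun_add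
      ((hasDerivWithinAt_id s _).mul_const (α (beta α r t) : ℝ))
  have h_anti := antitoneOn_of_forall_hasDerivWithinAt_nonpos (convex_Icc 0 t) h_deriv
    (fun s hs => by
      rw [decayField_coe, neg_add_nonpos_iff]
      exact NNReal.coe_le_coe.2 (hα.monotone (hα.antitoneOn_beta r hs.1 ht hs.2)))
    (left_mem_Icc.2 ht) (right_mem_Icc.2 ht) ht
  simp only [hα.beta_zero_time] at h_anti
  linarith

theorem beta_le_euler {B L : ℝ≥0} (hL : LipschitzOnWith L α (Icc 0 B)) {r s : ℝ≥0} (hrs : r ≤ s)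
    (hs : s ≤ B) {η : ℝ} (hη : (s : ℝ) ≤ r + η) :
    (beta α r t : ℝ) ≤ r - t * α s + t * (L * (η + t * α B)) := by
  have h_le : beta α r t ≤ s := (hα.beta_le ht r).trans hrs
  have h_drop : (s : ℝ) - beta α r t ≤ η + t * α B :=
    calc (s : ℝ) - beta α r t ≤ η + t * α r := by linarith [hα.sub_mul_le_beta ht r]
      _ ≤ η + t * α B := by gcongr; exact hα.monotone (hrs.trans hs)
  have h_rate : (α s : ℝ) - α (beta α r t) ≤ L * (η + t * α B) :=
    calc (α s : ℝ) - α (beta α r t) ≤ L * dist s (beta α r t) :=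
        (le_abs_self _).trans (hL.dist_le_mul s ⟨zero_le, hs⟩ _ ⟨zero_le, h_le.trans hs⟩)
      _ ≤ L * (η + t * α B) := by
        rw [NNReal.dist_eq, abs_of_nonneg (sub_nonneg.2 (NNReal.coe_le_coe.2 h_le))]
        gcongr
  linarith [hα.beta_le_sub_mul ht r, mul_le_mul_of_nonneg_left h_rate ht]

end IsDecayRate

end Decay

/-! ### The Hamiltonian and the viscosity notions -/

section Viscosity

variable {n m : ℕ} {U : Set (EuclideanSpace ℝ (Fin m))}
  {f : EuclideanSpace ℝ (Fin n) × U → EuclideanSpace ℝ (Fin n)} {K : ℝ≥0}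
  {α : ℝ≥0 → ℝ≥0} {h : EuclideanSpace ℝ (Fin n) → ℝ≥0}

theorem IsControlDynamics.inner_le_maxRate (hf : IsControlDynamics f K)
    (x p : EuclideanSpace ℝ (Fin n)) (v : U) : inner ℝ p (f (x, v)) ≤ maxRate f x p := by
  obtain ⟨M, -, hM⟩ := hf.exists_pos_norm_le x
  refine le_ciSup (f := fun v : U => inner ℝ p (f (x, v))) ⟨‖p‖ * M, ?_⟩ v
  rintro _ ⟨w, rfl⟩
  exact (real_inner_le_norm _ _).trans (by gcongr; exact hM w)

theorem maxRate_zero (f : EuclideanSpace ℝ (Fin n) × U → EuclideanSpace ℝ (Fin n))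
    (x : EuclideanSpace ℝ (Fin n)) : maxRate f x 0 = 0 := by
  simp [maxRate]

theorem hamiltonian_nonneg_iff {x p : EuclideanSpace ℝ (Fin n)} {r : ℝ≥0} :
    0 ≤ hamiltonian f α x r p ↔ -(α r : ℝ) ≤ maxRate f x p :=
  neg_le_iff_add_nonneg.symm

theorem IsViscosityCBF.continuous (hcbf : IsViscosityCBF f α fun x => h x) : Continuous h :=
  NNReal.isEmbedding_coe.continuous_iff.2 hcbf.1

theorem IsViscosityCBF.hamiltonian_nonneg
    (hcbf : IsViscosityCBF f α fun x => h x) {φ : EuclideanSpace ℝ (Fin n) → ℝ}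
    (hφ : ContDiff ℝ 1 φ) {x : EuclideanSpace ℝ (Fin n)}
    (h_max : IsLocalMax (fun y => (h y : ℝ) - φ y) x) : 0 ≤ hamiltonian f α x (h x) (∇ φ x) := by
  rw [hamiltonian_nonneg_iff]
  rcases eq_zero_or_pos (h x) with hx | hx
  · -- At a zero of `h ≥ 0` the test function has a local minimum, so its gradient vanishes.
    have h_min : IsLocalMin φ x := by
      filter_upwards [h_max] with y hy
      rw [hx, NNReal.coe_zero] at hy
      linarith [(h y).coe_nonneg]
    have h_grad : ∇ φ x = 0 := by rw [gradient, h_min.fderiv_eq_zero, map_zero]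
    rw [h_grad, maxRate_zero]
    exact neg_nonpos.2 (NNReal.coe_nonneg _)
  · simpa only [Real.toNNReal_coe] using hcbf.2 x hx φ hφ h_max

theorem IsViscosityCBF.isViscositySolution (hcbf : IsViscosityCBF f α fun x => h x) :
    IsViscositySolution (fun x r p => -min (hamiltonian f α x r p) 0) h :=
  ⟨⟨hcbf.continuous, fun _ hφ _ h_max =>
      neg_nonpos.2 (le_min (hcbf.hamiltonian_nonneg hφ h_max) le_rfl)⟩,
    hcbf.continuous, fun _ _ _ _ => neg_nonneg.2 (min_le_right _ _)⟩

theorem IsViscositySubsolution.isViscosityCBF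
    (h_sub : IsViscositySubsolution (fun x r p => -min (hamiltonian f α x r p) 0) h) :
    IsViscosityCBF f α fun x => h x := by
  refine ⟨NNReal.continuous_coe.comp h_sub.1, fun x _ φ hφ h_max => ?_⟩
  rw [Real.toNNReal_coe]
  exact hamiltonian_nonneg_iff.1 (le_min_iff.1 (neg_nonpos.1 (h_sub.2 φ hφ x h_max))).1

end Viscosity

/-! ### The control barrier value function -/

section ValueFunction

variable {n m : ℕ} {U : Set (EuclideanSpace ℝ (Fin m))}
  {f : EuclideanSpace ℝ (Fin n) × U → EuclideanSpace ℝ (Fin n)}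
  {α : ℝ≥0 → ℝ≥0} {g : EuclideanSpace ℝ (Fin n) → ℝ≥0} {x : EuclideanSpace ℝ (Fin n)} {T w : ℝ≥0}

theorem iInf_beta_le {ξ : ℝ → EuclideanSpace ℝ (Fin n)} {t : ℝ} (ht : t ∈ Icc (0 : ℝ) T) :
    ⨅ t : Icc (0 : ℝ) T, beta α (g (ξ t)) (T - t) ≤ beta α (g (ξ t)) (T - t) :=
  ciInf_le (OrderBot.bddBelow _) (⟨t, ht⟩ : Icc (0 : ℝ) T)

theorem beta_mem_upperBounds_payoffs (f : EuclideanSpace ℝ (Fin n) × U → EuclideanSpace ℝ (Fin n))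
    (α : ℝ≥0 → ℝ≥0) (g : EuclideanSpace ℝ (Fin n) → ℝ≥0) (x : EuclideanSpace ℝ (Fin n)) (T : ℝ≥0) :
    beta α (g x) T ∈ upperBounds {w : ℝ≥0 | ∃ (u : ℝ → U) (ξ : ℝ → EuclideanSpace ℝ (Fin n)),
      Measurable u ∧ IsTrajectory f u x ξ ∧
        w = ⨅ t : Icc (0 : ℝ) T, beta α (g (ξ t)) (T - t)} := by
  rintro _ ⟨u, ξ, -, hξ, rfl⟩
  simpa only [hξ.apply_zero, sub_zero] using
    iInf_beta_le (α := α) (g := g) (ξ := ξ) (left_mem_Icc.2 T.coe_nonneg)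

theorem cbvfPayoff_le_beta (f : EuclideanSpace ℝ (Fin n) × U → EuclideanSpace ℝ (Fin n))
    (α : ℝ≥0 → ℝ≥0) (g : EuclideanSpace ℝ (Fin n) → ℝ≥0) (x : EuclideanSpace ℝ (Fin n)) (T : ℝ≥0) :
    cbvfPayoff f α g x T ≤ beta α (g x) T :=
  csSup_le' (beta_mem_upperBounds_payoffs f α g x T)

theorem IsTrajectory.le_cbvfPayoff {u : ℝ → U} {ξ : ℝ → EuclideanSpace ℝ (Fin n)}
    (hξ : IsTrajectory f u x ξ) (hu : Measurable u)
    (hw : ∀ t ∈ Icc (0 : ℝ) T, w ≤ beta α (g (ξ t)) (T - t)) : w ≤ cbvfPayoff f α g x T := by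
  have : Nonempty (Icc (0 : ℝ) T) := ⟨⟨0, left_mem_Icc.2 T.coe_nonneg⟩⟩
  exact (le_ciInf fun t : Icc (0 : ℝ) T => hw t t.2).trans
    (le_csSup ⟨_, beta_mem_upperBounds_payoffs f α g x T⟩ ⟨u, ξ, hu, hξ, rfl⟩)

variable (hα : IsDecayRate α)
include hα

theorem exists_isTrajectory_of_lt_cbvfPayoff (hw : w < cbvfPayoff f α g x T) :
    ∃ (u : ℝ → U) (ξ : ℝ → EuclideanSpace ℝ (Fin n)),
      Measurable u ∧ IsTrajectory f u x ξ ∧ w < g (ξ T) := by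
  obtain ⟨_, ⟨u, ξ, hu, hξ, rfl⟩, hwξ⟩ := exists_lt_of_lt_csSup' hw
  refine ⟨u, ξ, hu, hξ, hwξ.trans_le ?_⟩
  simpa only [sub_self, hα.beta_zero_time] using
    iInf_beta_le (α := α) (g := g) (ξ := ξ) (right_mem_Icc.2 T.coe_nonneg)

theorem beta_cbvf (f : EuclideanSpace ℝ (Fin n) × U → EuclideanSpace ℝ (Fin n))
    (g : EuclideanSpace ℝ (Fin n) → ℝ≥0) (x : EuclideanSpace ℝ (Fin n)) (T : ℝ≥0) :
    beta α (cbvf f α g x T) T = cbvfPayoff f α g x T := by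
  have h_mem : cbvfPayoff f α g x T ∈ Icc (beta α 0 T) (beta α (g x) T) := by
    rw [hα.beta_zero_left T.coe_nonneg]
    exact ⟨zero_le, cbvfPayoff_le_beta f α g x T⟩
  obtain ⟨v, -, hv⟩ := intermediate_value_Icc (zero_le (a := g x))
    (hα.continuous_beta_left T.coe_nonneg).continuousOn h_mem
  exact Classical.epsilon_spec (p := fun v => beta α v T = cbvfPayoff f α g x T) ⟨v, hv⟩

theorem cbvf_eq_iff : cbvf f α g x T = w ↔ cbvfPayoff f α g x T = beta α w T := by
  rw [← beta_cbvf hα]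
  exact (hα.injective_beta_left T.coe_nonneg).eq_iff.symm

theorem ProvidesBarrierGuarantee.beta_le_cbvfPayoff
    (hB : ProvidesBarrierGuarantee f α fun x => g x) (hx : 0 < g x) {θ : ℝ} (hθ : θ ∈ Ico 0 1) :
    beta α (θ * g x).toNNReal T ≤ cbvfPayoff f α g x T := by
  obtain ⟨u, ξ, hu, hξ, h_le⟩ := hB.2 θ hθ.1 hθ.2 x hx
  refine hξ.le_cbvfPayoff hu fun t ht => ?_
  have ht' := sub_nonneg.2 ht.2
  calc beta α (θ * g x).toNNReal T = beta α (beta α (θ * g x).toNNReal t) (T - t) := by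
        rw [hα.beta_beta ht' _ ht.1, add_sub_cancel]
    _ ≤ beta α (g (ξ t)) (T - t) :=
        (hα.strictMono_beta_left ht').monotone (NNReal.coe_le_coe.1 (h_le t ht.1))

theorem ProvidesBarrierGuarantee.cbvf_eq (hB : ProvidesBarrierGuarantee f α fun x => g x)
    (x : EuclideanSpace ℝ (Fin n)) (T : ℝ≥0) : cbvf f α g x T = g x := by
  rw [cbvf_eq_iff hα]
  refine le_antisymm (cbvfPayoff_le_beta f α g x T) ?_
  rcases eq_zero_or_pos (g x) with hx | hx
  · rw [hx, hα.beta_zero_left T.coe_nonneg]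
    exact zero_le
  have h_cont : Continuous fun θ : ℝ => beta α (θ * g x).toNNReal T :=
    (hα.continuous_beta_left T.coe_nonneg).comp
      (continuous_real_toNNReal.comp (continuous_id.mul continuous_const))
  have h_lim : Tendsto (fun θ : ℝ => beta α (θ * g x).toNNReal T) (𝓝[<] 1)
      (𝓝 (beta α (g x) T)) :=
    (h_cont.tendsto' 1 _ (by simp)).mono_left nhdsWithin_le_nhds
  refine le_of_tendsto h_lim ?_
  filter_upwards [Ico_mem_nhdsLT (zero_lt_one (α := ℝ))] with θ hθ
    using hB.beta_le_cbvfPayoff hα hx hθ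

theorem exists_isTrajectory_of_cbvf_eq (h_inv : cbvf f α g x T = g x) (hx : 0 < g x) {ε : ℝ}
    (hε : 0 < ε) : ∃ (u : ℝ → U) (ξ : ℝ → EuclideanSpace ℝ (Fin n)),
      Measurable u ∧ IsTrajectory f u x ξ ∧ (beta α (g x) T : ℝ) - ε < g (ξ T) := by
  have h_pos : 0 < beta α (g x) T := by
    simpa only [hα.beta_zero_left T.coe_nonneg] using hα.strictMono_beta_left T.coe_nonneg hx
  have h_lt : ((beta α (g x) T : ℝ) - ε).toNNReal < cbvfPayoff f α g x T := by
    rw [(cbvf_eq_iff hα).1 h_inv, ← NNReal.coe_lt_coe, Real.coe_toNNReal']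
    exact max_lt (sub_lt_self _ hε) (NNReal.coe_pos.2 h_pos)
  obtain ⟨u, ξ, hu, hξ, h_gt⟩ := exists_isTrajectory_of_lt_cbvfPayoff hα h_lt
  exact ⟨u, ξ, hu, hξ, (Real.le_coe_toNNReal _).trans_lt (NNReal.coe_lt_coe.2 h_gt)⟩

end ValueFunction

/-! ### Supergradients along trajectories -/

section Supergradient

variable {E 𝒰 : Type*} [NormedAddCommGroup E] [InnerProductSpace ℝ E] {g φ : E → ℝ} {p x : E}

/-- `p` belongs to the Fréchet superdifferential `D⁺g(x)`, the set of gradients at `x` of functions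
touching `g` from above at `x`. -/
def IsSupergradientAt (g : E → ℝ) (p x : E) : Prop :=
  ∀ ε > 0, ∀ᶠ y in 𝓝 x, g y ≤ g x + inner ℝ p (y - x) + ε * ‖y - x‖

theorem eventually_mul_lt (a : ℝ) {c : ℝ} (hc : 0 < c) : ∀ᶠ t in 𝓝[>] (0 : ℝ), a * t < c :=
  (((continuous_const_mul a).tendsto' 0 0 (mul_zero a)).mono_left
    nhdsWithin_le_nhds).eventually_lt_const hc

variable [CompleteSpace E]

theorem isSupergradientAt_of_isLocalMax (h_max : IsLocalMax (fun y => g y - φ y) x)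
    (hφ : HasGradientAt φ p x) : IsSupergradientAt g p x := fun ε hε => by
  filter_upwards [h_max, (hasGradientAt_iff_isLittleO.1 hφ).def hε] with y h_le h_small
  linarith [(abs_le.1 h_small).2]

theorem IsSupergradientAt.eventually_le_add_mul [MeasurableSpace E] [MeasurableSpace 𝒰]
    {f : E × 𝒰 → E} {K : ℝ≥0} (hp : IsSupergradientAt g p x) (hf : IsControlDynamics f K) {b c : ℝ}
    (hb : ∀ v, inner ℝ p (f (x, v)) ≤ b) (hbc : b < c) :
    ∀ᶠ T in 𝓝[>] (0 : ℝ), ∀ u ξ, ξ 0 = x → IsTrajectoryOn f u (Icc 0 T) ξ →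
      g (ξ T) ≤ g x + T * c := by
  obtain ⟨M, hM0, hM⟩ := hf.exists_pos_norm_le x
  have hη : 0 < (c - b) / 2 := half_pos (sub_pos.2 hbc)
  obtain ⟨ρ, hρ, h_ball⟩ := Metric.eventually_nhds_iff.1
    (hp ((c - b) / 2 / (2 * M)) (by positivity))
  filter_upwards [self_mem_nhdsWithin, eventually_mul_lt K one_half_pos,
    eventually_mul_lt (2 * M) hρ, eventually_mul_lt (‖p‖ * (K * (2 * M))) hη]
    with T (hT : 0 < T) hKT hTρ hT_speed u ξ hξ0 hξ
  have h_near := hξ.norm_sub_le hf.lipschitzWith hKT.le (hξ0 ▸ hM)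
  rw [hξ0] at h_near
  have h_inner := hξ.inner_sub_le hT.le p (c := b + (c - b) / 2) fun t ht => by
    calc inner ℝ p (f (ξ t, u t))
        = inner ℝ p (f (x, u t)) + inner ℝ p (f (ξ t, u t) - f (x, u t)) := by
          rw [← inner_add_right, add_sub_cancel]
      _ ≤ b + ‖p‖ * (K * (2 * M * T)) := by
          refine add_le_add (hb _) ((real_inner_le_norm _ _).trans ?_)
          gcongr
          exact ((hf.lipschitzWith _).norm_sub_le _ _).trans (by gcongr; exact h_near t ht)
      _ ≤ b + (c - b) / 2 := by linarith
  rw [hξ0] at h_inner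
  have h_dist := h_near T (right_mem_Icc.2 hT.le)
  calc g (ξ T) ≤ g x + inner ℝ p (ξ T - x) + (c - b) / 2 / (2 * M) * ‖ξ T - x‖ :=
        h_ball (by rw [dist_eq_norm]; exact h_dist.trans_lt hTρ)
    _ ≤ g x + T * (b + (c - b) / 2) + (c - b) / 2 / (2 * M) * (2 * M * T) := by gcongr
    _ = g x + T * c := by field_simp; ring

end Supergradient

section ValueFunction

variable {n m : ℕ} {U : Set (EuclideanSpace ℝ (Fin m))}
  {f : EuclideanSpace ℝ (Fin n) × U → EuclideanSpace ℝ (Fin n)} {K : ℝ≥0}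
  {α : ℝ≥0 → ℝ≥0} {h : EuclideanSpace ℝ (Fin n) → ℝ≥0}

theorem neg_le_maxRate_of_cbvf_eq (hf : IsControlDynamics f K) (hα : IsDecayRate α)
    {x p : EuclideanSpace ℝ (Fin n)} (h_inv : ∀ T, cbvf f α h x T = h x) (hx : 0 < h x)
    (hp : IsSupergradientAt (fun y => (h y : ℝ)) p x) : -(α (h x) : ℝ) ≤ maxRate f x p := by
  refine le_of_forall_pos_lt_add fun ε hε => ?_
  obtain ⟨T, h_upper, hT⟩ := ((hp.eventually_le_add_mul hf (c := maxRate f x p + ε / 2)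
    (hf.inner_le_maxRate x p) (by linarith)).and self_mem_nhdsWithin).exists
  lift T to ℝ≥0 using hT.le
  replace hT : 0 < (T : ℝ) := hT
  obtain ⟨u, ξ, hu, hξ, h_lower⟩ :=
    exists_isTrajectory_of_cbvf_eq hα (h_inv T) hx (ε := T * (ε / 2)) (by positivity)
  have h_gain := h_upper u ξ hξ.apply_zero ((hξ.isTrajectoryOn hf hu).mono Icc_subset_Ici_self)
  have h_decay := hα.sub_mul_le_beta T.coe_nonneg (h x)
  have h_rate : (T : ℝ) * -(α (h x) : ℝ) < T * (maxRate f x p + ε) := by linarith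
  exact lt_of_mul_lt_mul_left h_rate hT.le

theorem isViscosityCBF_of_cbvf_eq (hf : IsControlDynamics f K) (hα : IsDecayRate α)
    (hh : Continuous h) (h_inv : ∀ T x, cbvf f α h x T = h x) :
    IsViscosityCBF f α fun x => h x := by
  refine ⟨NNReal.continuous_coe.comp hh, fun x hx φ hφ h_max => ?_⟩
  rw [Real.toNNReal_coe]
  exact neg_le_maxRate_of_cbvf_eq hf hα (fun T => h_inv T x) (NNReal.coe_pos.1 hx)
    (isSupergradientAt_of_isLocalMax h_max (hφ.differentiable one_ne_zero x).hasGradientAt)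

end ValueFunction

/-! ### Sup-convolution -/

section SupConvolution

variable {E : Type*} [NormedAddCommGroup E] {g : E → ℝ} {q : ℝ} {S : Set E} {y z : E}

/-- The function `w ↦ g(w) - q‖w - z‖²`, whose supremum over `w` is the sup-convolution of `g` at
`z`. -/
def penalize (g : E → ℝ) (q : ℝ) (z w : E) : ℝ := g w - q * ‖w - z‖ ^ 2

/-- The sup-convolution `sup_{w ∈ S} (g(w) - q‖w - z‖²)` over `S`, a semiconvex approximation of `g`
from above. It is used for `S` compact and `g` continuous, where the supremum is attained. -/
def supConv (g : E → ℝ) (q : ℝ) (S : Set E) (z : E) : ℝ := sSup (penalize g q z '' S)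

theorem continuousOn_penalize (hg : ContinuousOn g S) (q : ℝ) (z : E) :
    ContinuousOn (penalize g q z) S :=
  hg.sub (by fun_prop)

theorem penalize_le_supConv (hS : IsCompact S) (hg : ContinuousOn g S) (q : ℝ) (hy : y ∈ S) :
    penalize g q z y ≤ supConv g q S z :=
  le_csSup (hS.bddAbove_image (continuousOn_penalize hg q z)) (mem_image_of_mem _ hy)

theorem le_supConv (hS : IsCompact S) (hg : ContinuousOn g S) (q : ℝ) (hz : z ∈ S) :
    g z ≤ supConv g q S z := by
  simpa [penalize] using penalize_le_supConv hS hg q (z := z) hz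

theorem supConv_eq_of_isMaxOn (hy : y ∈ S) (h_max : IsMaxOn (penalize g q z) S y) :
    supConv g q S z = penalize g q z y :=
  IsGreatest.csSup_eq ⟨mem_image_of_mem _ hy, forall_mem_image.2 h_max⟩

theorem supConv_le_of_isMaxOn (hq : 0 ≤ q) (hy : y ∈ S) (h_max : IsMaxOn (penalize g q z) S y) :
    supConv g q S z ≤ g y :=
  (supConv_eq_of_isMaxOn hy h_max).trans_le (sub_le_self _ (by positivity))

theorem add_mul_sq_le_of_isMaxOn_penalize (hz : z ∈ S) (h_max : IsMaxOn (penalize g q z) S y) :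
    g z + q * ‖y - z‖ ^ 2 ≤ g y := by
  have h_le : penalize g q z z ≤ penalize g q z y := h_max hz
  simp only [penalize, sub_self, norm_zero] at h_le
  linarith

theorem exists_forall_exists_isMaxOn_penalize (hS : IsCompact S) (hg : ContinuousOn g S) {η r : ℝ}
    (hη : 0 < η) (hr : 0 < r) :
    ∃ q > 0, ∀ z ∈ S, ∃ y ∈ S, IsMaxOn (penalize g q z) S y ∧ ‖y - z‖ < r ∧ g y ≤ g z + η := by
  obtain ⟨ρ, hρ, h_unif⟩ := Metric.uniformContinuousOn_iff.1
    (hS.uniformContinuousOn_of_continuous hg) η hη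
  obtain ⟨G, hG, hgG⟩ := (hS.image_of_continuousOn hg).isBounded.exists_pos_norm_le
  have h_bound {w : E} (hw : w ∈ S) : |g w| ≤ G := hgG _ (mem_image_of_mem _ hw)
  obtain ⟨σ, hσ, hσ_lt⟩ := exists_between (lt_min hρ hr)
  refine ⟨2 * G / σ ^ 2, by positivity, fun z hz => ?_⟩
  obtain ⟨y, hy, h_max⟩ := hS.exists_isMaxOn ⟨z, hz⟩ (continuousOn_penalize hg (2 * G / σ ^ 2) z)
  have h_sq : ‖y - z‖ ^ 2 ≤ σ ^ 2 := by
    have h_pen := add_mul_sq_le_of_isMaxOn_penalize hz h_max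
    refine le_of_mul_le_mul_left (a := 2 * G / σ ^ 2) ?_ (by positivity)
    rw [div_mul_cancel₀ _ (by positivity)]
    linarith [(abs_le.1 (h_bound hz)).1, (abs_le.1 (h_bound hy)).2]
  have h_near : ‖y - z‖ < min ρ r := (le_of_sq_le_sq h_sq hσ.le).trans_lt hσ_lt
  refine ⟨y, hy, h_max, h_near.trans_le (min_le_right _ _), ?_⟩
  have h_osc := h_unif y hy z hz (by rw [dist_eq_norm]; exact h_near.trans_le (min_le_left _ _))
  linarith [(abs_lt.1 h_osc).2]

variable [InnerProductSpace ℝ E]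

theorem hasGradientAt_mul_norm_sub_sq [CompleteSpace E] (q : ℝ) (z y : E) :
    HasGradientAt (fun w => q * ‖w - z‖ ^ 2) ((2 * q) • (y - z)) y := by
  refine hasGradientAt_iff_hasFDerivAt.2 ((((hasFDerivAt_id y).sub_const z).norm_sq.const_mul
    q).congr_fderiv (ContinuousLinearMap.ext fun w => ?_))
  simp only [id_eq, map_sub, ContinuousLinearMap.comp_id, smul_apply, sub_apply,
    coe_innerSL_apply, nsmul_eq_mul, Nat.cast_ofNat, smul_eq_mul,
    map_smul, InnerProductSpace.toDual_apply_apply]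
  ring

theorem penalize_eq_add_inner (g : E → ℝ) (q : ℝ) (z z' y : E) :
    penalize g q z' y =
      penalize g q z y + inner ℝ ((2 * q) • (y - z)) (z' - z) - q * ‖z' - z‖ ^ 2 := by
  rw [penalize, penalize, ← sub_sub_sub_cancel_right y z' z, norm_sub_sq_real (y - z),
    real_inner_smul_left]
  ring

/-- The maximizer `y` at `ζ(0)` competes in the sup-convolution at `ζ(δ)`, so only the motion of
`ζ` in the direction of the gradient `2q(y - ζ(0))` matters to first order. -/
theorem IsTrajectoryOn.supConv_add_le {𝒰 : Type*} [CompleteSpace E] {f : E × 𝒰 → E} {K : ℝ≥0}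
    {u : ℝ → 𝒰} {ζ : ℝ → E} {δ b η ρ : ℝ} (hζ : IsTrajectoryOn f u (Icc 0 δ) ζ) (hδ : 0 ≤ δ)
    (hf : ∀ v, LipschitzWith K fun y => f (y, v)) (hS : IsCompact S) (hg : ContinuousOn g S)
    (hq : 0 ≤ q) (hy : y ∈ S) (h_max : IsMaxOn (penalize g q (ζ 0)) S y)
    (hb : ∀ v ∈ range u, b ≤ inner ℝ ((2 * q) • (y - ζ 0)) (f (y, v)))
    (hη : q * ‖y - ζ 0‖ ^ 2 ≤ η) (hy_near : ‖y - ζ 0‖ ≤ 1)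
    (hρ : ∀ t ∈ Icc 0 δ, ‖ζ t - ζ 0‖ ≤ ρ) :
    supConv g q S (ζ 0) + δ * (b - 2 * K * (η + q * ρ)) - q * ρ ^ 2 ≤ supConv g q S (ζ δ) := by
  have hρ0 : 0 ≤ ρ := (norm_nonneg _).trans (hρ δ (right_mem_Icc.2 hδ))
  have h_rate : δ * (b - 2 * K * (η + q * ρ)) ≤
      inner ℝ ((2 * q) • (y - ζ 0)) (ζ δ - ζ 0) := by
    refine hζ.le_inner_sub hδ _ fun t ht => ?_
    have h_dist : ‖y - ζ t‖ ≤ ‖y - ζ 0‖ + ρ :=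
      (norm_sub_le_norm_sub_add_norm_sub y (ζ 0) (ζ t)).trans
        (by gcongr; exact (norm_sub_rev _ _).trans_le (hρ t ht))
    have h_change :=
      calc inner ℝ ((2 * q) • (y - ζ 0)) (f (y, u t) - f (ζ t, u t))
          ≤ ‖(2 * q) • (y - ζ 0)‖ * (K * (‖y - ζ 0‖ + ρ)) :=
            (real_inner_le_norm _ _).trans (by
              gcongr; exact ((hf _).norm_sub_le _ _).trans (by gcongr))
        _ = 2 * K * (q * ‖y - ζ 0‖ ^ 2 + q * ρ * ‖y - ζ 0‖) := by
            rw [norm_smul, Real.norm_of_nonneg (by positivity)]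
            ring
        _ ≤ 2 * K * (η + q * ρ * 1) := by gcongr
    rw [inner_sub_right, mul_one] at h_change
    linarith [hb _ (mem_range_self t)]
  have h_sq : q * ‖ζ δ - ζ 0‖ ^ 2 ≤ q * ρ ^ 2 := by
    gcongr
    exact hρ δ (right_mem_Icc.2 hδ)
  have h_compete : penalize g q (ζ δ) y ≤ supConv g q S (ζ δ) := penalize_le_supConv hS hg q hy
  rw [penalize_eq_add_inner g q (ζ 0), ← supConv_eq_of_isMaxOn hy h_max] at h_compete
  linarith

theorem IsTrajectoryOn.beta_supConv_le {𝒰 : Type*} [CompleteSpace E] {f : E × 𝒰 → E} {K : ℝ≥0}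
    {u : ℝ → 𝒰} {ζ : ℝ → E} {δ η C : ℝ} (hζ : IsTrajectoryOn f u (Icc 0 δ) ζ) (hδ : 0 ≤ δ)
    (hf : ∀ v, LipschitzWith K fun y => f (y, v)) {α : ℝ≥0 → ℝ≥0} (hα : IsDecayRate α)
    {h : E → ℝ≥0} (hS : IsCompact S) (hh : ContinuousOn h S) {B L : ℝ≥0}
    (hL : LipschitzOnWith L α (Icc 0 B)) (hyB : h y ≤ B) (hq : 0 ≤ q) (hζS : ζ 0 ∈ S) (hy : y ∈ S)
    (h_max : IsMaxOn (penalize (fun x => h x) q (ζ 0)) S y) (hy_near : ‖y - ζ 0‖ ≤ 1)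
    (hy_le : (h y : ℝ) ≤ h (ζ 0) + η)
    (h_rate : ∀ v ∈ range u, -(α (h y) : ℝ) - η ≤ inner ℝ ((2 * q) • (y - ζ 0)) (f (y, v)))
    (hC : ∀ t ∈ Icc 0 δ, ‖ζ t - ζ 0‖ ≤ C * δ) :
    (beta α (supConv (fun x => h x) q S (ζ 0)).toNNReal δ : ℝ) ≤
      supConv (fun x => h x) q S (ζ δ) +
        δ * ((1 + 2 * K + L) * η + (2 * K * q * C + q * C ^ 2 + L * α B) * δ) := by
  have hg : ContinuousOn (fun x => (h x : ℝ)) S := NNReal.continuous_coe.comp_continuousOn hh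
  have h_le := le_supConv hS hg q hζS
  have h_pen := add_mul_sq_le_of_isMaxOn_penalize hζS h_max
  have h_conv_le := supConv_le_of_isMaxOn hq hy h_max
  have h_coe := Real.coe_toNNReal _ ((h (ζ 0)).coe_nonneg.trans h_le)
  have h_euler := hα.beta_le_euler hδ hL (Real.toNNReal_le_iff_le_coe.2 h_conv_le) hyB (η := η)
    (by rw [h_coe]; linarith)
  have h_step := hζ.supConv_add_le hδ hf hS hg hq hy h_max h_rate (η := η) (by linarith)
    hy_near hC
  rw [h_coe] at h_euler
  linarith

end SupConvolution

/-! ### Sample-and-hold feedback -/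

section BallEstimates

variable {E 𝒰 : Type*} [NormedAddCommGroup E] [NormedSpace ℝ E] [MeasurableSpace E]
  [MeasurableSpace 𝒰] {f : E × 𝒰 → E} {K : ℝ≥0} {x : E}

theorem IsTrajectoryOn.norm_sub_le_of_mem_closedBall {u : ℝ → 𝒰} {ζ : ℝ → E} {R M δ : ℝ}
    (hζ : IsTrajectoryOn f u (Icc 0 δ) ζ) (hf : IsControlDynamics f K)
    (hM : ∀ v, ‖f (x, v)‖ ≤ M) (h_ball : ζ 0 ∈ Metric.closedBall x R) (hKδ : K * δ ≤ 1 / 2) :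
    ∀ t ∈ Icc 0 δ, ‖ζ t - ζ 0‖ ≤ 2 * (M + K * R) * δ :=
  hζ.norm_sub_le hf.lipschitzWith hKδ fun v =>
    (hf.norm_le_add hM (ζ 0) v).trans (by gcongr; exact mem_closedBall_iff_norm.1 h_ball)

theorem IsControlDynamics.eventually_le_add [ProperSpace E] (hf : IsControlDynamics f K)
    {g : E → ℝ} (hg : Continuous g) (x : E) (R : ℝ) {ε : ℝ} (hε : 0 < ε) :
    ∀ᶠ δ in 𝓝[>] (0 : ℝ), ∀ u ζ, ζ 0 ∈ Metric.closedBall x R →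
      IsTrajectoryOn f u (Icc 0 δ) ζ → ∀ t ∈ Icc 0 δ, g (ζ 0) ≤ g (ζ t) + ε := by
  obtain ⟨M, -, hM⟩ := hf.exists_pos_norm_le x
  obtain ⟨ρ, hρ, h_unif⟩ := Metric.uniformContinuousOn_iff.1
    ((isCompact_closedBall x (R + 1)).uniformContinuousOn_of_continuous hg.continuousOn) ε hε
  filter_upwards [eventually_mul_lt K one_half_pos,
    eventually_mul_lt (2 * (M + K * R)) (lt_min hρ one_pos)] with δ hKδ hδρ u ζ h_ball hζ t ht
  have h_near : ‖ζ t - ζ 0‖ < min ρ 1 :=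
    (hζ.norm_sub_le_of_mem_closedBall hf hM h_ball hKδ.le t ht).trans_lt hδρ
  rw [mem_closedBall_iff_norm] at h_ball
  have h_osc := h_unif (ζ 0) (mem_closedBall_iff_norm.2 (by linarith)) (ζ t)
    (mem_closedBall_iff_norm.2 (by
      linarith [norm_sub_le_norm_sub_add_norm_sub (ζ t) (ζ 0) x,
        h_near.trans_le (min_le_right _ _)]))
    (by rw [dist_comm, dist_eq_norm]; exact h_near.trans_le (min_le_left _ _))
  linarith [(abs_lt.1 h_osc).2]

theorem IsControlDynamics.exists_isTrajectoryOn_of_sampled_step [CompleteSpace E] [Nonempty 𝒰]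
    (hf : IsControlDynamics f K) {δ T : ℝ} (hδ : 0 < δ) (hKδ : K * δ ≤ 1 / 2) {P Q : ℝ → E → Prop}
    (h_step : ∀ s ∈ Icc 0 T, ∀ z, P s z → ∃ v, ∀ ζ, ζ 0 = z →
      IsTrajectoryOn f (fun _ => v) (Icc 0 δ) ζ →
        P (s + δ) (ζ δ) ∧ ∀ t ∈ Icc 0 δ, Q (s + t) (ζ t)) (hx : P 0 x) :
    ∃ u ξ, Measurable u ∧ ξ 0 = x ∧ IsTrajectoryOn f u (Ici 0) ξ ∧ ∀ t ∈ Icc 0 T, Q t (ξ t) := by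
  have h_piece : ∀ s, 0 ≤ s → ∀ z, (s ≤ T → P s z) → ∃ u ζ, Measurable u ∧ ζ 0 = z ∧
      IsTrajectoryOn f u (Icc 0 δ) ζ ∧ (s + δ ≤ T → P (s + δ) (ζ δ)) ∧
        ∀ t ∈ Icc 0 δ, s + t ≤ T → Q (s + t) (ζ t) := fun s hs z hz => by
    have h_control : ∃ v, ∀ ζ, ζ 0 = z → IsTrajectoryOn f (fun _ => v) (Icc 0 δ) ζ → s ≤ T →
        P (s + δ) (ζ δ) ∧ ∀ t ∈ Icc 0 δ, Q (s + t) (ζ t) := by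
      by_cases hsT : s ≤ T
      · obtain ⟨v, hv⟩ := h_step s ⟨hs, hsT⟩ z (hz hsT)
        exact ⟨v, fun ζ hζ0 hζ _ => hv ζ hζ0 hζ⟩
      · exact ⟨Classical.arbitrary 𝒰, fun _ _ _ h_le => absurd h_le hsT⟩
    obtain ⟨v, hv⟩ := h_control
    obtain ⟨ζ, hζ0, hζ⟩ := exists_isTrajectoryOn_const (hf.lipschitzWith v) hδ.le hKδ z
    exact ⟨_, ζ, measurable_const, hζ0, hζ, fun h_le => (hv ζ hζ0 hζ (by linarith)).1,
      fun t ht h_le => (hv ζ hζ0 hζ (by linarith [ht.1])).2 t ht⟩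
  obtain ⟨u, ξ, hu, hξ0, hξ, hQ⟩ := exists_isTrajectoryOn_Ici_of_step hδ
    (P := fun s z => s ≤ T → P s z) (Q := fun t z => t ≤ T → Q t z) h_piece fun _ => hx
  exact ⟨u, ξ, hu, hξ0, hξ, fun t ht => hQ t ht.1 ht.2⟩

end BallEstimates

section Feedback

variable {n m : ℕ} {U : Set (EuclideanSpace ℝ (Fin m))} [Nonempty U]
  {f : EuclideanSpace ℝ (Fin n) × U → EuclideanSpace ℝ (Fin n)} {K : ℝ≥0}
  {α : ℝ≥0 → ℝ≥0} {h : EuclideanSpace ℝ (Fin n) → ℝ≥0}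

namespace IsViscosityCBF

theorem exists_lt_inner (hcbf : IsViscosityCBF f α fun x => h x)
    {φ : EuclideanSpace ℝ (Fin n) → ℝ} (hφ : ContDiff ℝ 1 φ) {x p : EuclideanSpace ℝ (Fin n)}
    (hp : HasGradientAt φ p x) (h_max : IsLocalMax (fun y => (h y : ℝ) - φ y) x) {η : ℝ}
    (hη : 0 < η) : ∃ v : U, -(α (h x) : ℝ) - η < inner ℝ p (f (x, v)) := by
  have h_rate := hamiltonian_nonneg_iff.1 (hcbf.hamiltonian_nonneg hφ h_max)
  rw [hp.gradient] at h_rate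
  exact exists_lt_of_lt_ciSup ((sub_lt_self _ hη).trans_le h_rate)

theorem exists_penalty_control (hcbf : IsViscosityCBF f α fun x => h x)
    (x : EuclideanSpace ℝ (Fin n)) (R : ℝ) {η : ℝ} (hη : 0 < η) :
    ∃ q > 0, ∀ z ∈ Metric.closedBall x R, ∃ y ∈ Metric.closedBall x (R + 1),
      IsMaxOn (penalize (fun w => h w) q z) (Metric.closedBall x (R + 1)) y ∧ ‖y - z‖ < 1 ∧
      (h y : ℝ) ≤ h z + η ∧
      ∃ v : U, -(α (h y) : ℝ) - η < inner ℝ ((2 * q) • (y - z)) (f (y, v)) := by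
  obtain ⟨q, hq, h_maximizer⟩ := exists_forall_exists_isMaxOn_penalize
    (isCompact_closedBall x (R + 1)) hcbf.1.continuousOn hη one_pos
  refine ⟨q, hq, fun z hz => ?_⟩
  obtain ⟨y, hy, h_max, h_near, hy_le⟩ :=
    h_maximizer z (Metric.closedBall_subset_closedBall (by linarith) hz)
  have hy_ball : y ∈ Metric.ball x (R + 1) := by
    rw [← dist_eq_norm] at h_near
    exact (dist_triangle y z x).trans_lt (by linarith [Metric.mem_closedBall.1 hz])
  exact ⟨y, hy, h_max, h_near, hy_le, hcbf.exists_lt_inner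
    (contDiff_const.mul ((contDiff_id.sub contDiff_const).norm_sq ℝ))
    (hasGradientAt_mul_norm_sub_sq q z y)
    (h_max.isLocalMax (Metric.closedBall_mem_nhds_of_mem hy_ball)) hη⟩

theorem exists_approx_decay (hf : IsControlDynamics f K) (hα : IsDecayRate α)
    (hcbf : IsViscosityCBF f α fun x => h x) (x : EuclideanSpace ℝ (Fin n)) (R : ℝ) {ε : ℝ}
    (hε : 0 < ε) :
    ∃ a : EuclideanSpace ℝ (Fin n) → ℝ≥0,
      (∀ z ∈ Metric.closedBall x R, h z ≤ a z ∧ (a z : ℝ) ≤ h z + ε) ∧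
      ∀ᶠ δ in 𝓝[>] (0 : ℝ), ∀ z ∈ Metric.closedBall x R, ∃ v : U, ∀ ζ, ζ 0 = z →
        IsTrajectoryOn f (fun _ => v) (Icc 0 δ) ζ →
          (beta α (a z) δ : ℝ) ≤ a (ζ δ) + δ * ε := by
  set S := Metric.closedBall x (R + 1)
  have hS : IsCompact S := isCompact_closedBall x (R + 1)
  have h_sub : Metric.closedBall x R ⊆ S := Metric.closedBall_subset_closedBall (by linarith)
  obtain ⟨B, hB⟩ := hS.bddAbove_image hcbf.continuous.continuousOn
  obtain ⟨L, hL⟩ := hα.exists_lipschitzOnWith B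
  obtain ⟨M, -, hM⟩ := hf.exists_pos_norm_le x
  obtain ⟨η, hη, hηε⟩ : ∃ η > 0, (2 + 2 * K + L) * η = ε :=
    ⟨ε / (2 + 2 * K + L), by positivity, mul_div_cancel₀ _ (by positivity)⟩
  have hη_le : η ≤ ε := hηε ▸ le_mul_of_one_le_left hη.le
    (by linarith [K.coe_nonneg, L.coe_nonneg])
  obtain ⟨q, hq, h_maximizer⟩ := hcbf.exists_penalty_control x R hη
  refine ⟨fun z => (supConv (fun y => h y) q S z).toNNReal, fun z hz => ?_, ?_⟩
  · obtain ⟨y, hy, h_max, -, hy_le, -⟩ := h_maximizer z hz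
    refine ⟨NNReal.le_toNNReal_of_coe_le (le_supConv hS hcbf.1.continuousOn q (h_sub hz)), ?_⟩
    rw [Real.coe_toNNReal', max_le_iff]
    exact ⟨(supConv_le_of_isMaxOn hq.le hy h_max).trans (by linarith), by positivity⟩
  set C := 2 * (M + K * R)
  filter_upwards [self_mem_nhdsWithin, eventually_mul_lt K one_half_pos,
    eventually_mul_lt (2 * K * q * C + q * C ^ 2 + L * α B) hη]
    with δ (hδ : 0 < δ) hKδ h_small z hz
  obtain ⟨y, hy, h_max, h_near, hy_le, v, hv⟩ := h_maximizer z hz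
  refine ⟨v, fun ζ hζ0 hζ => ?_⟩
  subst hζ0
  calc _ ≤ _ := hζ.beta_supConv_le hδ.le hf.lipschitzWith hα hS hcbf.continuous.continuousOn hL
        (hB (mem_image_of_mem h hy)) hq.le (h_sub hz) hy h_max h_near.le hy_le
        (by rintro _ ⟨_, rfl⟩; exact hv.le)
        (hζ.norm_sub_le_of_mem_closedBall hf hM hz hKδ.le)
    _ ≤ (supConv (fun y => h y) q S (ζ δ)).toNNReal + δ * ((1 + 2 * K + L) * η + η) := by
      gcongr
      exact Real.le_coe_toNNReal _
    _ = _ := by rw [← hηε]; ring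

theorem exists_isTrajectoryOn_beta_sub_le (hf : IsControlDynamics f K) (hα : IsDecayRate α)
    (hcbf : IsViscosityCBF f α fun x => h x) (x : EuclideanSpace ℝ (Fin n))
    {T c : ℝ} (hT : 0 ≤ T) (hKT : K * T ≤ 1 / 4) (hc : 0 < c) :
    ∃ (u : ℝ → U) (ξ : ℝ → EuclideanSpace ℝ (Fin n)), Measurable u ∧ ξ 0 = x ∧
      IsTrajectoryOn f u (Ici 0) ξ ∧ ∀ t ∈ Icc 0 T, (beta α (h x) t : ℝ) - c ≤ h (ξ t) := by
  obtain ⟨M, hM0, hM⟩ := hf.exists_pos_norm_le x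
  obtain ⟨ε, hε, hεc⟩ : ∃ ε > 0, (T + 2) * ε = c :=
    ⟨c / (T + 2), by positivity, mul_div_cancel₀ _ (by positivity)⟩
  -- `4M` bounds the speed as long as the state stays in the ball of radius `4MT` that it allows.
  have h_speed : 2 * (M + K * (4 * M * T)) ≤ 4 * M := by
    linarith [mul_le_mul_of_nonneg_right hKT hM0.le]
  obtain ⟨a, ha, h_decay⟩ := hcbf.exists_approx_decay hf hα x (4 * M * T) hε
  obtain ⟨δ, h_step, h_osc, hKδ, (hδ : 0 < δ)⟩ := (h_decay.and ((hf.eventually_le_add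
    hcbf.1 x (4 * M * T) hε).and
      ((eventually_mul_lt K one_half_pos).and self_mem_nhdsWithin))).exists
  refine hf.exists_isTrajectoryOn_of_sampled_step (x := x) hδ hKδ.le
    (P := fun s z => ‖z - x‖ ≤ 4 * M * s ∧ (beta α (h x) s : ℝ) ≤ a z + s * ε)
    (Q := fun t z => (beta α (h x) t : ℝ) - c ≤ h z)
    (fun s hs z ⟨h_dist, h_le⟩ => ?_) ⟨by simp, by
      simpa [hα.beta_zero_time] using (ha x (Metric.mem_closedBall_self (by positivity))).1⟩
  have h_ball : z ∈ Metric.closedBall x (4 * M * T) :=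
    mem_closedBall_iff_norm.2 (h_dist.trans (by gcongr; exact hs.2))
  obtain ⟨v, hv⟩ := h_step z h_ball
  refine ⟨v, fun ζ hζ0 hζ => ⟨⟨?_, ?_⟩, fun t ht => ?_⟩⟩ <;> subst hζ0
  · have h_move := hζ.norm_sub_le_of_mem_closedBall hf hM h_ball hKδ.le δ (right_mem_Icc.2 hδ.le)
    linarith [norm_sub_le_norm_sub_add_norm_sub (ζ δ) (ζ 0) x,
      mul_le_mul_of_nonneg_right h_speed hδ.le]
  · have h_decayed := hα.beta_le_beta_add hδ.le (mul_nonneg hs.1 hε.le) h_le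
    rw [hα.beta_beta hδ.le _ hs.1] at h_decayed
    linarith [hv ζ rfl hζ]
  · have h_anti : (beta α (h x) (s + t) : ℝ) ≤ beta α (h x) s :=
      hα.antitoneOn_beta _ hs.1 (add_nonneg hs.1 ht.1) (le_add_of_nonneg_right ht.1)
    have h_error : s * ε ≤ T * ε := by gcongr; exact hs.2
    linarith [h_osc _ ζ h_ball hζ t ht, (ha _ h_ball).2]

theorem exists_isTrajectoryOn_beta_lt (hf : IsControlDynamics f K) (hα : IsDecayRate α)
    (hcbf : IsViscosityCBF f α fun x => h x) {x : EuclideanSpace ℝ (Fin n)} {T : ℝ} (hT : 0 ≤ T)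
    (hKT : K * T ≤ 1 / 4) {r : ℝ≥0} (hr : r < h x) :
    ∃ (u : ℝ → U) (ξ : ℝ → EuclideanSpace ℝ (Fin n)), Measurable u ∧ ξ 0 = x ∧
      IsTrajectoryOn f u (Ici 0) ξ ∧ ∀ t ∈ Icc 0 T, beta α r t < h (ξ t) := by
  obtain ⟨s, hs, h_min⟩ := isCompact_Icc.exists_isMinOn (nonempty_Icc.2 hT)
    (f := fun t => (beta α (h x) t : ℝ) - beta α r t)
    (((hα.continuousOn_beta (h x)).sub (hα.continuousOn_beta r)).mono Icc_subset_Ici_self)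
  have h_gap : 0 < (beta α (h x) s : ℝ) - beta α r s :=
    sub_pos.2 (NNReal.coe_lt_coe.2 (hα.strictMono_beta_left hs.1 hr))
  obtain ⟨u, ξ, hu, hξ0, hξ, h_ge⟩ :=
    hcbf.exists_isTrajectoryOn_beta_sub_le hf hα x hT hKT (half_pos h_gap)
  refine ⟨u, ξ, hu, hξ0, hξ, fun t ht => NNReal.coe_lt_coe.1 ?_⟩
  have h_gap_le : (beta α (h x) s : ℝ) - beta α r s ≤ beta α (h x) t - beta α r t := h_min ht
  linarith [h_ge t ht]

theorem providesBarrierGuarantee (hf : IsControlDynamics f K) (hα : IsDecayRate α)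
    (hcbf : IsViscosityCBF f α fun x => h x) : ProvidesBarrierGuarantee f α fun x => h x := by
  refine ⟨hcbf.1, fun θ hθ0 hθ1 x (hx : (0 : ℝ) < h x) => ?_⟩
  have hr : (θ * h x).toNNReal < h x := by
    rw [← NNReal.coe_lt_coe, Real.coe_toNNReal _ (by positivity)]
    exact mul_lt_of_lt_one_left hx hθ1
  obtain ⟨T, hT, hKT⟩ := exists_pos_mul_lt (show (0 : ℝ) < 1 / 4 by norm_num) K
  have h_piece : ∀ s, 0 ≤ s → ∀ z, beta α (θ * h x).toNNReal s < h z →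
      ∃ (u : ℝ → U) (ξ : ℝ → EuclideanSpace ℝ (Fin n)), Measurable u ∧ ξ 0 = z ∧
        IsTrajectoryOn f u (Icc 0 T) ξ ∧ beta α (θ * h x).toNNReal (s + T) < h (ξ T) ∧
        ∀ t ∈ Icc 0 T, beta α (θ * h x).toNNReal (s + t) < h (ξ t) := fun s hs z hz => by
    obtain ⟨u, ξ, hu, hξ0, hξ, h_gt⟩ := hcbf.exists_isTrajectoryOn_beta_lt hf hα hT.le hKT.le hz
    have h_gt' : ∀ t ∈ Icc 0 T, beta α (θ * h x).toNNReal (s + t) < h (ξ t) := fun t ht => by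
      rw [← hα.beta_beta ht.1 _ hs]
      exact h_gt t ht
    exact ⟨u, ξ, hu, hξ0, hξ.mono Icc_subset_Ici_self, h_gt' T (right_mem_Icc.2 hT.le), h_gt'⟩
  obtain ⟨u, ξ, hu, rfl, hξ, h_gt⟩ := exists_isTrajectoryOn_Ici_of_step hT
    (P := fun s z => beta α (θ * h x).toNNReal s < h z)
    (Q := fun s z => beta α (θ * h x).toNNReal s < h z) h_piece (by rwa [hα.beta_zero_time])
  exact ⟨u, ξ, hu, hξ.isTrajectory, fun t ht => NNReal.coe_le_coe.2 (h_gt t ht).le⟩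

end IsViscosityCBF

end Feedback

end ViscosityCBF

end

theorem theorem2_general {n m : ℕ} {U : Set (EuclideanSpace ℝ (Fin m))} (hU : U.Nonempty)
    {f : EuclideanSpace ℝ (Fin n) × U → EuclideanSpace ℝ (Fin n)} {K : ℝ≥0}
    (hf : ViscosityCBF.IsControlDynamics f K)
    {α : ℝ≥0 → ℝ≥0} (hα : ViscosityCBF.IsDecayRate α)
    {h : EuclideanSpace ℝ (Fin n) → ℝ≥0} (hh : Continuous h) :
    List.TFAE [
      ViscosityCBF.IsViscosityCBF f α (fun x => (h x : ℝ)),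
      ViscosityCBF.IsViscositySolution
        (fun x r p => -min (ViscosityCBF.hamiltonian f α x r p) 0) h,
      ∀ (T : ℝ≥0) (x : EuclideanSpace ℝ (Fin n)), ViscosityCBF.cbvf f α h x T = h x,
      ViscosityCBF.ProvidesBarrierGuarantee f α (fun x => (h x : ℝ))] := by
  have : Nonempty U := hU.to_subtype
  tfae_have 1 → 2 := ViscosityCBF.IsViscosityCBF.isViscositySolution
  tfae_have 2 → 1 := fun h_sol => h_sol.1.isViscosityCBF
  tfae_have 1 → 4 := ViscosityCBF.IsViscosityCBF.providesBarrierGuarantee hf hα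
  tfae_have 4 → 3 := fun hB T x => hB.cbvf_eq hα x T
  tfae_have 3 → 1 := ViscosityCBF.isViscosityCBF_of_cbvf_eq hf hα hh
  tfae_finish

theorem theorem2 {n m : ℕ} (U : Set (EuclideanSpace ℝ (Fin m)))
    (hU : IsCompact U) (hU' : U.Nonempty)
    (f : EuclideanSpace ℝ (Fin n) × U → EuclideanSpace ℝ (Fin n))
    (hf : ∃ K : ℝ≥0, LipschitzWith K f)
    (α : ℝ≥0 → ℝ≥0) (hα : ViscosityCBF.IsClassK α) (hα' : LocallyLipschitz α)
    (h : EuclideanSpace ℝ (Fin n) → ℝ≥0) (hh : Continuous h) :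
    List.TFAE [
      ViscosityCBF.IsViscosityCBF f α (fun x => (h x : ℝ)),
      ViscosityCBF.IsViscositySolution
        (fun x r p => -min (ViscosityCBF.hamiltonian f α x r p) 0) h,
      ∀ (T : ℝ≥0) (x : EuclideanSpace ℝ (Fin n)), ViscosityCBF.cbvf f α h x T = h x,
      ViscosityCBF.ProvidesBarrierGuarantee f α (fun x => (h x : ℝ))] := by
  obtain ⟨K, hK⟩ := hf
  exact theorem2_general hU' (ViscosityCBF.isControlDynamics_of_isCompact hU hK)
    (hα.isDecayRate hα') hh
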